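/- Let $k$ be a field of characteristic zero and let $K$ be a field extension of $k$ of finite transcendence degree. Let $f:K\times K\to K$ be a Poisson bracket on $K$ over $k$, i.e. an alternating $k$-bilinear map satisfying $f(ab,c)=a f(b,c)+b f(a,c)$ and $f(f(a,b),c)+f(f(b,c),a)+f(f(c,a),b)=0$. Let $E\subset \mathrm{Der}_k(K)$ be the $K$-subspace spanned by the derivations $\bar a=f(a,\cdot)$, $a\in K$ (the module of weak Hamiltonian derivations), let $\varphi$ be the $K$-bilinear form on $E$ determined by $\varphi(\bar a,\bar b)=f(a,b)$, and let $\phi:E\to E^*=\mathrm{Hom}_K(E,K)$, $x\mapsto\varphi(x,\cdot)$. Then: 1. $f$ can be quantized: there is an associative unital $k[[\hbar]]$-algebra $K_\hbar$ with an isomorphism of $k[[\hbar]]$-modules $K_\hbar\cong K[[\hbar]]$ that induces an algebra isomorphism $K_\hbar/\hbar K_\hbar\cong K$ and under which the product of $x,y\in K$ has the form $xy+\hbar f(x,y)+\sum_{i\ge 2}\hbar^i F_i(x,y)$ with $F_i(x,y)\in K$. 2. $E$ is finite-dimensional over $K$, and $\phi$ is an injective map between spaces of equal dimension, $\dim_K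 E=\dim_K E^*$. Consequently $f$ is locally free ($E$ is a free $K$-module of finite rank; $K$ is regarded as a sheaf over a point) and nonsingular ($\phi$ is an isomorphism). -/

import Mathlib

open scoped PowerSeries

universe u v

/-- A Poisson bracket on a commutative `k`-algebra `A`: an alternating `k`-bilinear map
`A × A → A` that satisfies the Leibniz rule and the Jacobi identity. -/
structure PoissonBracket (k : Type u) (A : Type v) [CommRing k] [CommRing A] [Algebra k A] where
  /-- the underlying `k`-bilinear map -/
  bracket : A →ₗ[k] A →ₗ[k] A
  bracket_self : ∀ a, bracket a a = 0
  leibniz : ∀ a b c, bracket (a * b) c = a * bracket b c + b * bracket a c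
  jacobi : ∀ a b c,
    bracket (bracket a b) c + bracket (bracket b c) a + bracket (bracket c a) b = 0

namespace PoissonBracket

variable {k : Type u} {A : Type v} [CommRing k] [CommRing A] [Algebra k A]

theorem skew (f : PoissonBracket k A) (a b : A) : f.bracket a b = -f.bracket b a := by
  have h := f.bracket_self (a + b)
  simp only [map_add, LinearMap.add_apply, f.bracket_self, zero_add, add_zero] at h
  exact eq_neg_of_add_eq_zero_right h

/-- The strong Hamiltonian derivation `f(a, ·)` of `A` defined by an element `a`. -/
def hamiltonian (f : PoissonBracket k A) (a : A) : Derivation k A A :=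
  Derivation.mk' (f.bracket a) fun b c => by
    rw [f.skew a (b * c), f.leibniz, f.skew a b, f.skew a c]
    simp only [smul_eq_mul]
    ring

@[simp]
theorem hamiltonian_apply (f : PoissonBracket k A) (a b : A) :
    f.hamiltonian a b = f.bracket a b := rfl

/-- The module `E` of weak Hamiltonian derivations: the `A`-submodule of `Der_k(A)` generated
by the strong Hamiltonian derivations. -/
def weakHamiltonian (f : PoissonBracket k A) : Submodule A (Derivation k A A) :=
  Submodule.span A (Set.range f.hamiltonian)

/-- A strong Hamiltonian derivation, as an element of `E`. -/
def toWeak (f : PoissonBracket k A) (a : A) : f.weakHamiltonian :=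
  ⟨f.hamiltonian a, Submodule.subset_span ⟨a, rfl⟩⟩

theorem exists_combination (f : PoissonBracket k A) (y : f.weakHamiltonian) :
    ∃ v : A →₀ A, Finsupp.linearCombination A f.hamiltonian v = (y : Derivation k A A) := by
  have h : (y : Derivation k A A) ∈ Submodule.span A (Set.range f.hamiltonian) := y.2
  rwa [← Finsupp.range_linearCombination] at h

theorem combination_apply (f : PoissonBracket k A) (v : A →₀ A) (a : A) :
    Finsupp.linearCombination A f.hamiltonian v a =
      Finsupp.linearCombination A (fun b => f.bracket b a) v := by
  induction v using Finsupp.induction_linear with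
  | zero => simp
  | add v w hv hw => simp [hv, hw]
  | single b c => simp

theorem pairing_eq_zero (f : PoissonBracket k A) (x : f.weakHamiltonian) (v : A →₀ A)
    (hv : Finsupp.linearCombination A f.hamiltonian v = 0) :
    Finsupp.linearCombination A (fun b => (x : Derivation k A A) b) v = 0 := by
  obtain ⟨w, hw⟩ := f.exists_combination x
  have key : ∀ a, Finsupp.linearCombination A (fun b => f.bracket a b) v = 0 := by
    intro a
    have h := f.combination_apply v a
    rw [hv] at h
    have e : (fun b => f.bracket a b) = fun b => -f.bracket b a := funext fun b => f.skew a b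
    rw [e]
    simp only [Finsupp.linearCombination_apply, smul_neg, Finsupp.sum_neg] at h ⊢
    rw [← h]
    simp
  rw [← hw]
  clear hw
  induction w using Finsupp.induction_linear with
  | zero => simp [Finsupp.linearCombination_apply]
  | add w w' h h' =>
    simp only [Finsupp.linearCombination_apply, map_add, Derivation.add_apply, smul_add,
      Finsupp.sum_add] at h h' ⊢
    simp only [h, h', add_zero]
  | single a c =>
    have h := key a
    simp only [Finsupp.linearCombination_apply] at h
    simp only [Finsupp.linearCombination_apply, Finsupp.sum_single_index, zero_smul,
      Derivation.smul_apply, hamiltonian_apply, smul_eq_mul] at h ⊢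
    simp only [mul_left_comm _ c]
    rw [← Finsupp.mul_sum, h, mul_zero]

/-- The value of the form at `x` and `y = ∑ b, v b • f(b, ·)`, namely `∑ b, v b * x b`. -/
noncomputable def formAux (f : PoissonBracket k A) (x y : f.weakHamiltonian) : A :=
  Finsupp.linearCombination A (fun b => (x : Derivation k A A) b)
    (Classical.choose (f.exists_combination y))

theorem formAux_eq (f : PoissonBracket k A) (x y : f.weakHamiltonian) (v : A →₀ A)
    (hv : Finsupp.linearCombination A f.hamiltonian v = (y : Derivation k A A)) :
    f.formAux x y = Finsupp.linearCombination A (fun b => (x : Derivation k A A) b) v := by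
  have h := f.pairing_eq_zero x (Classical.choose (f.exists_combination y) - v) (by
    rw [map_sub, Classical.choose_spec (f.exists_combination y), hv, sub_self])
  rw [map_sub, sub_eq_zero] at h
  exact h

/-- The `A`-bilinear form `φ` on `E` induced by the bracket; see `form_toWeak`, which determines
it uniquely. -/
noncomputable def form (f : PoissonBracket k A) :
    f.weakHamiltonian →ₗ[A] f.weakHamiltonian →ₗ[A] A :=
  LinearMap.mk₂ A f.formAux
    (fun x x' y => by
      obtain ⟨v, hv⟩ := f.exists_combination y
      rw [f.formAux_eq _ y v hv, f.formAux_eq _ y v hv, f.formAux_eq _ y v hv]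
      simp [Finsupp.linearCombination_apply, mul_add, Finsupp.sum_add])
    (fun c x y => by
      obtain ⟨v, hv⟩ := f.exists_combination y
      rw [f.formAux_eq _ y v hv, f.formAux_eq _ y v hv]
      simp [Finsupp.linearCombination_apply, Finsupp.mul_sum, mul_left_comm])
    (fun x y y' => by
      obtain ⟨v, hv⟩ := f.exists_combination y
      obtain ⟨v', hv'⟩ := f.exists_combination y'
      rw [f.formAux_eq _ _ (v + v') (by simp [hv, hv']), f.formAux_eq _ y v hv,
        f.formAux_eq _ y' v' hv', map_add])
    (fun c x y => by
      obtain ⟨v, hv⟩ := f.exists_combination y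
      rw [f.formAux_eq _ _ (c • v) (by simp [hv]), f.formAux_eq _ y v hv, map_smul])

/-- The form satisfies `φ(x, f(b, ·)) = x(b)`. -/
theorem form_apply_toWeak (f : PoissonBracket k A) (x : f.weakHamiltonian) (b : A) :
    f.form x (f.toWeak b) = (x : Derivation k A A) b := by
  change f.formAux x (f.toWeak b) = _
  rw [f.formAux_eq x (f.toWeak b) (Finsupp.single b 1) (by simp [toWeak])]
  simp

/-- The form satisfies `φ(f(a, ·), f(b, ·)) = f(a, b)`. -/
theorem form_toWeak (f : PoissonBracket k A) (a b : A) :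
    f.form (f.toWeak a) (f.toWeak b) = f.bracket a b :=
  f.form_apply_toWeak (f.toWeak a) b

/-- The map `E → E*`, `x ↦ φ(x, ·)`. -/
noncomputable def toDual (f : PoissonBracket k A) :
    f.weakHamiltonian →ₗ[A] Module.Dual A f.weakHamiltonian :=
  f.form

/-- The bracket is locally free, `A` being regarded as a sheaf over a one-point space: the module
of weak Hamiltonian derivations is free of finite rank over `A`. -/
def IsLocallyFree (f : PoissonBracket k A) : Prop :=
  Module.Finite A f.weakHamiltonian ∧ Module.Free A f.weakHamiltonian

/-- The bracket is nonsingular: the map `E → E*` is an isomorphism. -/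
def IsNonsingular (f : PoissonBracket k A) : Prop :=
  Function.Bijective f.toDual

end PoissonBracket

/-- A deformation of a commutative `k`-algebra `A`: an associative unital `k⟦ħ⟧`-algebra with an
isomorphism of `k⟦ħ⟧`-modules to `A⟦ħ⟧`, such that the constant term (whose kernel consists of the
multiples of `ħ`) is a homomorphism to `A`; so the deformed algebra modulo `ħ` is the algebra
`A`. -/
structure FormalDeformation (k : Type u) (A : Type v) [CommRing k] [CommRing A] [Algebra k A] where
  /-- the deformed algebra -/
  carrier : Type v
  [ring : Ring carrier]
  [algebra : Algebra k⟦X⟧ carrier]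
  /-- the isomorphism of modules with `A⟦ħ⟧` -/
  toSeries : carrier ≃ₗ[k⟦X⟧] A⟦X⟧
  constantCoeff_one : PowerSeries.constantCoeff (toSeries 1) = 1
  constantCoeff_mul : ∀ x y : carrier, PowerSeries.constantCoeff (toSeries (x * y)) =
    PowerSeries.constantCoeff (toSeries x) * PowerSeries.constantCoeff (toSeries y)

namespace FormalDeformation

variable {k : Type u} {A : Type v} [CommRing k] [CommRing A] [Algebra k A]

attribute [instance] FormalDeformation.ring FormalDeformation.algebra

/-- The deformed product of two elements of `A`, as a power series `∑ ħ ^ i F_i(x, y)`. -/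
noncomputable def star (D : FormalDeformation k A) (x y : A) : A⟦X⟧ :=
  D.toSeries (D.toSeries.symm (PowerSeries.C x) * D.toSeries.symm (PowerSeries.C y))

end FormalDeformation

/-- The bracket can be quantized: there is a deformation of `A` whose product has the form
`x * y + ħ f(x, y) + O(ħ ^ 2)`. -/
def PoissonBracket.IsQuantizable {k : Type u} {A : Type v} [CommRing k] [CommRing A] [Algebra k A]
    (f : PoissonBracket k A) : Prop :=
  ∃ D : FormalDeformation k A, ∀ x y : A, PowerSeries.coeff 1 (D.star x y) = f.bracket x y

/-!
The bracket is quantized by an algebraic version of Fedosov's construction, carried out inside the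
ring of `k`-linear operators on a polynomial ring over `K`.

*The Poisson side.* In characteristic zero a derivation of `K` is determined by its values on a
transcendence basis, so `Der_k(K)`, and with it `E`, is finite-dimensional
(`Derivation.finiteDimensional_of_trdeg_lt`). Since `φ(x, f(b, ·)) = x(b)`, the map `E → E*` is
injective, hence bijective by dimension. Choose `y i` in `K` whose Hamiltonian derivations form a
basis of `E`; the matrix `P` of the brackets `f(y i, y j)` is then invertible. The rows of its
inverse `N` give derivations `d i` in `E` with `d i (y j) = δ i j`. As `E` is closed under
commutators and its elements are determined by their values on the `y j`, the `d i` commute, and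
`f(a, c) = ∑ d i a * d j c * P i j`. The Jacobi identity says that `N` is closed:
`d i (N j l) + d j (N l i) + d l (N i j) = 0` (`PoissonBracket.gram_inv_closed`).
So `f` is a symplectic structure in a commuting frame.

*The flat frame.* By symplectic linear algebra `P = ξ * J * ξᵀ` with `J` skew and integral, hence
killed by every derivation. Let `S` be the Weyl algebra over `K` attached to `J`, acting on
polynomials by left Moyal multiplication. The commutator with a linear generator acts on `S` as a
constant vector field, so that a Poincaré lemma holds with coefficients in `S`
(`FedosovData.exists_primitive_one`, `FedosovData.exists_primitive_two`). The `d i`, acting on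
coefficients, are commuting operators `∇ i` that preserve `S` because `J` is constant. Take
generators `e i` of `S` with commutators `ω = -N / 2`. They are corrected order by order to series
`u i = e i + X (∇ i + …) + …`, where all omitted terms have coefficients in `S`, such that
`⁅u i, u j⁆ = ω i j` exactly (`FedosovData.exists_frame`). Here the Jacobi identity for the `u i`
and the closedness of `ω` make the error at each order a closed `2`-form, which the Poincaré lemma
removes.

*Flat sections.* As `ω` is central in `S`, the operators `⁅u i, ·⁆` commute on series over `S`. By
the Poincaré lemma for `1`-forms the algebra of series killed by all of them is identified with
`K⟦X⟧` by the symbol map, and to first order the flat section with symbol `a` is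
`a - X ∑ d i a * x i` for the frame `x` dual to `e`. The product of the flat sections of `a` and `b`
has symbol `a * b + X ^ 2 ∑ d i a * d j b * σ (x i * x j) + …`, and the dual frame is chosen with
`σ (x i * x j) = P i j`. Everything is compatible with the parity automorphism of `S` combined with
`X ↦ -X`; the invariant flat sections only involve `ħ = X ^ 2` in their symbols and form the
deformation of `K` (`FedosovData.exists_deformation`).
-/

section Commutators

-- Brackets `⁅a, b⁆` of ring elements are commutators.
attribute [local instance] LieRing.ofAssociativeRing

/-! ### Commutators and power series over noncommutative rings -/

namespace Ring

variable {R : Type*} [Ring R]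

theorem lie_mul (a b c : R) : ⁅a, b * c⁆ = ⁅a, b⁆ * c + b * ⁅a, c⁆ := by
  simp only [Ring.lie_def]
  noncomm_ring

theorem lie_pow_eq_zero {a b : R} (h : ⁅a, b⁆ = 0) (n : ℕ) : ⁅a, b ^ n⁆ = 0 := by
  rw [Ring.lie_def, sub_eq_zero] at h ⊢
  exact Commute.pow_right h n

theorem lie_smul {k : Type*} [CommRing k] [Algebra k R] (c : k) (a b : R) :
    ⁅a, c • b⁆ = c • ⁅a, b⁆ := by
  simp [Ring.lie_def, smul_sub]

theorem map_lie {R' : Type*} [Ring R'] (f : R →+* R') (a b : R) : f ⁅a, b⁆ = ⁅f a, f b⁆ := by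
  simp [Ring.lie_def]

theorem neg_one_pow_mul_self (n : ℕ) : (-1 : R) ^ n * (-1) ^ n = 1 := by
  rw [← pow_add, Even.neg_one_pow ⟨n, rfl⟩]

end Ring

namespace PowerSeries

variable {R : Type*} [Ring R]

theorem lie_X_pow_mul (n : ℕ) (f g : R⟦X⟧) : ⁅f, X ^ n * g⁆ = X ^ n * ⁅f, g⁆ := by
  rw [Ring.lie_def, Ring.lie_def, mul_sub, mul_assoc, ← mul_assoc f, ← X_pow_mul, mul_assoc]

theorem X_pow_mul_lie (n : ℕ) (f g : R⟦X⟧) : ⁅X ^ n * f, g⁆ = X ^ n * ⁅f, g⁆ := by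
  rw [← lie_skew, lie_X_pow_mul, ← mul_neg, lie_skew]

theorem eq_zero_of_X_pow_mul_eq_zero {n : ℕ} {f : R⟦X⟧} (h : X ^ n * f = 0) : f = 0 := by
  ext d
  rw [← coeff_X_pow_mul f n d, h, map_zero, map_zero]

theorem constantCoeff_lie (f g : R⟦X⟧) :
    constantCoeff ⁅f, g⁆ = ⁅constantCoeff f, constantCoeff g⁆ := by
  simp [Ring.lie_def]

theorem coeff_lie_C (r : R) (f : R⟦X⟧) (n : ℕ) : coeff n ⁅C r, f⁆ = ⁅r, coeff n f⁆ := by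
  simp [Ring.lie_def, coeff_C_mul, coeff_mul_C]

theorem coeff_zero_mul' (f g : R⟦X⟧) : coeff 0 (f * g) = coeff 0 f * coeff 0 g := by
  simp [coeff_mul]

theorem coeff_one_mul' (f g : R⟦X⟧) :
    coeff 1 (f * g) = coeff 0 f * coeff 1 g + coeff 1 f * coeff 0 g := by
  rw [coeff_mul, Finset.Nat.sum_antidiagonal_eq_sum_range_succ fun i j => coeff i f * coeff j g]
  simp [Finset.sum_range_succ]

theorem coeff_two_mul' (f g : R⟦X⟧) : coeff 2 (f * g) =
    coeff 0 f * coeff 2 g + coeff 1 f * coeff 1 g + coeff 2 f * coeff 0 g := by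
  rw [coeff_mul, Finset.Nat.sum_antidiagonal_eq_sum_range_succ fun i j => coeff i f * coeff j g]
  simp [Finset.sum_range_succ]

theorem eq_zero_of_forall_X_pow_dvd {f : R⟦X⟧} (h : ∀ N, (X : R⟦X⟧) ^ (N + 1) ∣ f) : f = 0 := by
  ext n
  exact X_pow_dvd_iff.1 (h n) n n.lt_succ_self

/-- Successive approximation: families of power series that satisfy the coefficientwise
condition `q`, solve the problem `E` modulo higher and higher powers of the variable, and can be
improved without changing the terms already found, converge to a solution to all orders. -/
theorem exists_limit {ι : Type*} (q : ι → ℕ → R → Prop) (E : ℕ → (ι → R⟦X⟧) → Prop)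
    (u₀ : ι → R⟦X⟧) (hq₀ : ∀ i n, q i n (coeff n (u₀ i))) (hE₀ : E 0 u₀)
    (step : ∀ N u, (∀ i n, q i n (coeff n (u i))) → E N u →
      ∃ v, (∀ i n, q i n (coeff n (v i))) ∧ E (N + 1) v ∧ ∀ i, X ^ (N + 1) ∣ v i - u i)
    (cong : ∀ N u v, E N u → (∀ i, X ^ (N + 1) ∣ v i - u i) → E N v) :
    ∃ u, (∀ i n, q i n (coeff n (u i))) ∧ ∀ N, E N u := by
  let T : ℕ → Type _ := fun N => {u : ι → R⟦X⟧ // (∀ i n, q i n (coeff n (u i))) ∧ E N u}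
  have next : ∀ N (u : T N), ∃ v : T (N + 1), ∀ i, X ^ (N + 1) ∣ v.1 i - u.1 i := by
    rintro N ⟨u, hu, hE⟩
    obtain ⟨v, hv, hEv, h⟩ := step N u hu hE
    exact ⟨⟨v, hv, hEv⟩, h⟩
  choose nxt hnxt using next
  let s : ∀ N, T N := fun N => Nat.rec ⟨u₀, hq₀, hE₀⟩ (fun N u => nxt N u) N
  have hs : ∀ N i, X ^ (N + 1) ∣ (s (N + 1)).1 i - (s N).1 i := fun N => hnxt N (s N)
  have stable : ∀ n m i, n ≤ m → coeff n ((s m).1 i) = coeff n ((s n).1 i) := by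
    intro n m i h
    induction m, h using Nat.le_induction with
    | base => rfl
    | succ m hm ih =>
      rw [← ih, ← sub_eq_zero, ← map_sub]
      exact X_pow_dvd_iff.1 (hs m i) n (Nat.lt_succ_of_le hm)
  refine ⟨fun i => mk fun n => coeff n ((s n).1 i), fun i n => ?_, fun N => ?_⟩
  · rw [coeff_mk]
    exact (s n).2.1 i n
  · refine cong N (s N).1 _ (s N).2.2 fun i => X_pow_dvd_iff.2 fun n hn => ?_
    rw [map_sub, coeff_mk, stable n N i (Nat.le_of_lt_succ hn), sub_self]

/-- The ring endomorphism `∑ rₙ Xⁿ ↦ ∑ (-1)ⁿ θ(rₙ) Xⁿ` attached to a ring endomorphism `θ`. -/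
noncomputable def signMap (θ : R →+* R) : R⟦X⟧ →+* R⟦X⟧ where
  toFun f := mk fun n => (-1) ^ n * θ (coeff n f)
  map_one' := by
    ext n
    rw [coeff_mk, coeff_one]
    split_ifs with h <;> simp [h]
  map_zero' := by ext n; simp
  map_add' f g := by ext n; simp [mul_add]
  map_mul' f g := by
    ext n
    rw [coeff_mk, coeff_mul, coeff_mul, map_sum, Finset.mul_sum]
    refine Finset.sum_congr rfl fun p hp => ?_
    rw [coeff_mk, coeff_mk, map_mul, ← Finset.HasAntidiagonal.mem_antidiagonal.1 hp, pow_add,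
      mul_assoc, mul_assoc, ← mul_assoc _ (θ _) (θ _), ← mul_assoc (θ _) _ (θ _),
      ((Commute.neg_one_left (θ (coeff p.1 f))).pow_left p.2).eq]

theorem coeff_signMap (θ : R →+* R) (f : R⟦X⟧) (n : ℕ) :
    coeff n (signMap θ f) = (-1) ^ n * θ (coeff n f) :=
  coeff_mk n fun n => (-1) ^ n * θ (coeff n f)

end PowerSeries

section Fedosov

open PowerSeries

/-! ### The data of a Fedosov deformation -/

/-- Data for deforming `K` along commuting derivations `d i`: a ring `R` of operators that contains
`K` (by `scal`), a Weyl algebra `S` over `K` with a frame `e` of generators and the dual frame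
`x`, and covariant derivatives `nabla i` that lift the derivations `d i` and preserve `S`. The
commutators of the frame form a closed `2`-form `omega`. The symbol map `sig` retracts `S` onto `K`,
and `theta` is the parity automorphism. -/
structure FedosovData (k K R ι : Type*) [Field k] [CommRing K] [Algebra k K] [Ring R]
    [Algebra k R] [DecidableEq ι] where
  /-- the inclusion of the coefficients -/
  scal : K →ₐ[k] R
  /-- the Weyl algebra -/
  S : Subalgebra k R
  /-- the generators of the Weyl algebra -/
  e : ι → R
  /-- the elements dual to the generators -/
  x : ι → R
  /-- the commutators of the generators -/
  omega : ι → ι → K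
  /-- the derivations along which `K` is deformed -/
  d : ι → Derivation k K K
  /-- the covariant derivatives -/
  nabla : ι → R
  /-- the symbol map -/
  sig : R →ₗ[k] K
  /-- the parity automorphism -/
  theta : R →ₐ[k] R
  scal_mem : ∀ c, scal c ∈ S
  lie_scal : ∀ c, ∀ r ∈ S, ⁅r, scal c⁆ = 0
  e_mem : ∀ i, e i ∈ S
  x_mem : ∀ i, x i ∈ S
  lie_e : ∀ i j, ⁅e i, e j⁆ = scal (omega i j)
  lie_e_x : ∀ i j, ⁅e i, x j⁆ = if i = j then 1 else 0
  nilpotent : ∀ i, ∀ r ∈ S, ∃ N : ℕ, (fun s => ⁅e i, s⁆)^[N] r = 0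
  lie_nabla_scal : ∀ i c, ⁅nabla i, scal c⁆ = scal (d i c)
  lie_nabla_mem : ∀ i, ∀ r ∈ S, ⁅nabla i, r⁆ ∈ S
  lie_nabla_nabla : ∀ i j, ⁅nabla i, nabla j⁆ = 0
  omega_closed : ∀ i j l, d i (omega j l) + d j (omega l i) + d l (omega i j) = 0
  sig_scal_mul : ∀ c r, sig (scal c * r) = c * sig r
  sig_one : sig 1 = 1
  eq_scal : ∀ r ∈ S, (∀ i, ⁅e i, r⁆ = 0) → r = scal (sig r)
  theta_theta : ∀ r, theta (theta r) = r
  theta_scal : ∀ c, theta (scal c) = scal c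
  theta_e : ∀ i, theta (e i) = -e i
  theta_nabla : ∀ i, theta (nabla i) = nabla i
  theta_mem : ∀ r ∈ S, theta r ∈ S
  sig_theta : ∀ r, sig (theta r) = sig r
  sig_x : ∀ i, sig (x i) = 0

namespace FedosovData

variable {k K R ι : Type*} [Field k] [CommRing K] [Algebra k K] [Ring R]
    [Algebra k R] [DecidableEq ι] (W : FedosovData k K R ι)

theorem sig_scal (c : K) : W.sig (W.scal c) = c := by
  simpa [W.sig_one] using W.sig_scal_mul c 1

theorem lie_mem {r s : R} (hr : r ∈ W.S) (hs : s ∈ W.S) : ⁅r, s⁆ ∈ W.S :=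
  sub_mem (mul_mem hr hs) (mul_mem hs hr)

theorem lie_e_comm (i j : ι) {r : R} (hr : r ∈ W.S) :
    ⁅W.e i, ⁅W.e j, r⁆⁆ = ⁅W.e j, ⁅W.e i, r⁆⁆ := by
  rw [leibniz_lie, W.lie_e, ← lie_skew, W.lie_scal _ r hr, neg_zero, zero_add]

theorem lie_e_scal (i : ι) (c : K) : ⁅W.e i, W.scal c⁆ = 0 := W.lie_scal c _ (W.e_mem i)

/-! ### The Poincaré lemma for the Weyl algebra -/

theorem lie_e_x_pow (i : ι) (n : ℕ) :
    ⁅W.e i, W.x i ^ (n + 1)⁆ = ((n : k) + 1) • W.x i ^ n := by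
  induction n with
  | zero => simp [W.lie_e_x]
  | succ n ih =>
    rw [pow_succ, Ring.lie_mul, ih, W.lie_e_x, if_pos rfl, mul_one, smul_mul_assoc, ← pow_succ]
    push_cast
    module

theorem iterate_mem (i : ι) (n : ℕ) {r : R} (hr : r ∈ W.S) :
    (fun s => ⁅W.e i, s⁆)^[n] r ∈ W.S := by
  induction n with
  | zero => exact hr
  | succ n ih =>
    rw [Function.iterate_succ_apply']
    exact W.lie_mem (W.e_mem i) ih

theorem lie_iterate_eq_zero (i j : ι) (n : ℕ) {r : R} (hr : r ∈ W.S) (h : ⁅W.e j, r⁆ = 0) :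
    ⁅W.e j, (fun s => ⁅W.e i, s⁆)^[n] r⁆ = 0 := by
  induction n with
  | zero => exact h
  | succ n ih =>
    rw [Function.iterate_succ_apply', W.lie_e_comm _ _ (W.iterate_mem i n hr), ih, lie_zero]

/-- The locally nilpotent derivation `⁅e i, ·⁆` of the Weyl algebra has antiderivatives, given by
iterated integration by parts, `v = ∑ (-1)ⁿ / (n + 1)! xᵢⁿ⁺¹ (ad eᵢ)ⁿ w`. They are constant in the
directions in which the integrand is. -/
theorem exists_antiderivative [CharZero k] (i : ι) {w : R} (hw : w ∈ W.S) :
    ∃ v ∈ W.S, ⁅W.e i, v⁆ = w ∧ ∀ j, j ≠ i → ⁅W.e j, w⁆ = 0 → ⁅W.e j, v⁆ = 0 := by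
  obtain ⟨N, hN⟩ := W.nilpotent i w hw
  let D : ℕ → R := fun n => (fun s => ⁅W.e i, s⁆)^[n] w
  have hD : ∀ n, ⁅W.e i, D n⁆ = D (n + 1) := fun n =>
    (Function.iterate_succ_apply' (fun s => ⁅W.e i, s⁆) n w).symm
  have hDm : ∀ n, D n ∈ W.S := fun n => W.iterate_mem i n hw
  let c : ℕ → k := fun n => (-1) ^ n / (n.factorial : k)
  have hc : ∀ n : ℕ, -c (n + 1) * ((n : k) + 1) = c n := by
    intro n
    have h1 : (n.factorial : k) ≠ 0 := by exact_mod_cast n.factorial_ne_zero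
    have h2 : (n : k) + 1 ≠ 0 := by exact_mod_cast n.succ_ne_zero
    simp only [c, Nat.factorial_succ]
    push_cast
    field_simp
    ring
  refine ⟨∑ n ∈ Finset.range N, (-c (n + 1)) • (W.x i ^ (n + 1) * D n),
    sum_mem fun n _ => W.S.smul_mem (mul_mem (pow_mem (W.x_mem i) _) (hDm n)) _, ?_, ?_⟩
  · have key : ∀ n, ⁅W.e i, (-c (n + 1)) • (W.x i ^ (n + 1) * D n)⁆ =
        c n • (W.x i ^ n * D n) - c (n + 1) • (W.x i ^ (n + 1) * D (n + 1)) := by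
      intro n
      rw [Ring.lie_smul, Ring.lie_mul, W.lie_e_x_pow, hD, smul_mul_assoc, smul_add, smul_smul,
        hc, neg_smul, sub_eq_add_neg]
    rw [lie_sum, Finset.sum_congr rfl fun n _ => key n,
      Finset.sum_range_sub' (fun n => c n • (W.x i ^ n * D n)), show D N = 0 from hN]
    simp [c, D]
  · intro j hj h
    rw [lie_sum]
    refine Finset.sum_eq_zero fun n _ => ?_
    rw [Ring.lie_smul, Ring.lie_mul, Ring.lie_pow_eq_zero (by rw [W.lie_e_x, if_neg hj]),
      W.lie_iterate_eq_zero i j n hw h]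
    simp

/-- Poincaré lemma for `1`-forms with values in the Weyl algebra: directions are added one at a
time, with antiderivatives that are constant in the earlier ones. -/
theorem exists_primitive_one [CharZero k] (s : Finset ι) (β : ι → R) (hβ : ∀ i, β i ∈ W.S)
    (h : ∀ i ∈ s, ∀ j ∈ s, ⁅W.e i, β j⁆ = ⁅W.e j, β i⁆) :
    ∃ w ∈ W.S, ∀ i ∈ s, ⁅W.e i, w⁆ = β i := by
  induction s using Finset.induction_on with
  | empty => exact ⟨0, zero_mem _, by simp⟩
  | insert a s ha ih =>
    obtain ⟨w, hw, hwβ⟩ := ih fun i hi j hj =>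
      h i (Finset.mem_insert_of_mem hi) j (Finset.mem_insert_of_mem hj)
    obtain ⟨v, hv, hva, hvj⟩ := W.exists_antiderivative a
      (sub_mem (hβ a) (W.lie_mem (W.e_mem a) hw))
    refine ⟨w + v, add_mem hw hv, fun i hi => ?_⟩
    rcases Finset.mem_insert.1 hi with rfl | his
    · rw [lie_add, hva, add_sub_cancel]
    · have hia : i ≠ a := fun h => ha (h ▸ his)
      rw [lie_add, hwβ i his, hvj i hia, add_zero]
      rw [lie_sub, W.lie_e_comm i a hw, hwβ i his,
        h i hi a (Finset.mem_insert_self a s), sub_self]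

/-- Poincaré lemma for `2`-forms with values in the Weyl algebra, by induction on the set of
directions: the component of the primitive in a new direction solves a `1`-form problem in the old
ones. -/
theorem exists_primitive_two [CharZero k] (s : Finset ι) (F : ι → ι → R) (hF : ∀ i j, F i j ∈ W.S)
    (hself : ∀ i, F i i = 0) (hskew : ∀ i j, F i j = -F j i)
    (h : ∀ i j l, ⁅W.e i, F j l⁆ + ⁅W.e j, F l i⁆ + ⁅W.e l, F i j⁆ = 0) :
    ∃ ρ : ι → R, (∀ i, ρ i ∈ W.S) ∧ ∀ i ∈ s, ∀ j ∈ s, ⁅W.e i, ρ j⁆ - ⁅W.e j, ρ i⁆ = F i j := by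
  induction s using Finset.induction_on with
  | empty => exact ⟨0, fun _ => zero_mem _, by simp⟩
  | insert a s ha ih =>
    obtain ⟨ρ, hρ, hρF⟩ := ih
    obtain ⟨w, hw, hwβ⟩ := W.exists_primitive_one s (fun i => F i a + ⁅W.e a, ρ i⁆)
      (fun i => add_mem (hF i a) (W.lie_mem (W.e_mem a) (hρ i))) (by
        intro i hi j hj
        have h1 := h i j a
        rw [← hρF i hi j hj, hskew a i, lie_sub, lie_neg] at h1
        simp only [lie_add]
        rw [W.lie_e_comm i a (hρ j), W.lie_e_comm j a (hρ i), ← sub_eq_zero, ← h1]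
        abel)
    refine ⟨Function.update ρ a w, fun i => ?_, fun i hi j hj => ?_⟩
    · rcases eq_or_ne i a with rfl | hia
      · rwa [Function.update_self]
      · rw [Function.update_of_ne hia]
        exact hρ i
    · rcases Finset.mem_insert.1 hi with rfl | his <;> rcases Finset.mem_insert.1 hj with rfl | hjs
      · rw [sub_self, hself]
      · have hja : j ≠ i := fun h => ha (h ▸ hjs)
        rw [Function.update_self, Function.update_of_ne hja, hwβ j hjs, hskew i j]
        abel
      · have hia : i ≠ j := fun h => ha (h ▸ his)
        rw [Function.update_self, Function.update_of_ne hia, hwβ i his]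
        abel
      · have hia : i ≠ a := fun h => ha (h ▸ his)
        have hja : j ≠ a := fun h => ha (h ▸ hjs)
        rw [Function.update_of_ne hia, Function.update_of_ne hja, hρF i his j hjs]

end FedosovData

/-! ### Flat frames -/

namespace FedosovData

variable {k K R ι : Type*} [Field k] [CommRing K] [Algebra k K] [Ring R]
    [Algebra k R] [DecidableEq ι] (W : FedosovData k K R ι)

/-- The power series with coefficients in the Weyl algebra. -/
def seriesSubring : Subring R⟦X⟧ where
  carrier := {f | ∀ n, coeff n f ∈ W.S}
  mul_mem' {f g} hf hg n := by
    rw [coeff_mul]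
    exact sum_mem fun p _ => mul_mem (hf p.1) (hg p.2)
  one_mem' n := by
    rw [coeff_one]
    split_ifs
    exacts [one_mem _, zero_mem _]
  add_mem' {f g} hf hg n := by
    rw [map_add]
    exact add_mem (hf n) (hg n)
  zero_mem' n := by
    rw [map_zero]
    exact zero_mem _
  neg_mem' {f} hf n := by
    rw [map_neg]
    exact neg_mem (hf n)

theorem C_mem_seriesSubring {r : R} (hr : r ∈ W.S) : C r ∈ W.seriesSubring := fun n => by
  rw [coeff_C]
  split_ifs
  exacts [hr, zero_mem _]

theorem X_pow_mul_mem_seriesSubring {f : R⟦X⟧} (hf : f ∈ W.seriesSubring) (m : ℕ) :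
    X ^ m * f ∈ W.seriesSubring := fun n => by
  rw [coeff_X_pow_mul']
  split_ifs
  exacts [hf _, zero_mem _]

theorem lie_mem_seriesSubring {f g : R⟦X⟧} (hf : f ∈ W.seriesSubring) (hg : g ∈ W.seriesSubring) :
    ⁅f, g⁆ ∈ W.seriesSubring := sub_mem (mul_mem hf hg) (mul_mem hg hf)

theorem lie_C_scal {f : R⟦X⟧} (hf : f ∈ W.seriesSubring) (c : K) : ⁅f, C (W.scal c)⁆ = 0 := by
  ext n
  rw [← lie_skew, map_neg, coeff_lie_C, lie_skew, W.lie_scal c _ (hf n), map_zero]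

theorem lie_C_nabla_mem {f : R⟦X⟧} (hf : f ∈ W.seriesSubring) (i : ι) :
    ⁅C (W.nabla i), f⁆ ∈ W.seriesSubring := fun n => by
  rw [coeff_lie_C]
  exact W.lie_nabla_mem i _ (hf n)

/-- The condition on the `n`-th coefficient `r` of a deformation `u i` of the generator `e i`: the
series `u i` starts with `e i`, differs from `X * nabla i` by a series with coefficients in the
Weyl algebra, and changes sign under the parity automorphism combined with `X ↦ -X`. -/
def IsFrameCoeff (i : ι) (n : ℕ) (r : R) : Prop :=
  (n = 0 → r = W.e i) ∧ (r - if n = 1 then W.nabla i else 0) ∈ W.S ∧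
    W.theta r = (-1) ^ (n + 1) * r

/-- A deformation of the generator `e i`; see `IsFrameCoeff`. -/
def IsFrame (u : ι → R⟦X⟧) : Prop := ∀ i n, W.IsFrameCoeff i n (coeff n (u i))

variable {W} {u : ι → R⟦X⟧}

theorem IsFrame.constantCoeff (hu : W.IsFrame u) (i : ι) : constantCoeff (u i) = W.e i := by
  rw [← coeff_zero_eq_constantCoeff_apply]
  exact (hu i 0).1 rfl

theorem IsFrame.exists_eq (hu : W.IsFrame u) (i : ι) :
    ∃ g ∈ W.seriesSubring, u i = X ^ 1 * C (W.nabla i) + g := by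
  refine ⟨u i - X ^ 1 * C (W.nabla i), fun n => ?_, by abel⟩
  convert! (hu i n).2.1 using 1
  rw [map_sub, coeff_X_pow_mul', coeff_C]
  congr 1
  rcases n with _ | _ | n <;> simp

theorem IsFrame.signMap_eq (hu : W.IsFrame u) (i : ι) :
    signMap (W.theta : R →+* R) (u i) = -u i := by
  ext n
  have h : ((-1 : R) ^ n) * (-1) ^ (n + 1) = -1 := by
    rw [← pow_add, show n + (n + 1) = 2 * n + 1 by ring, pow_succ, pow_mul]
    simp
  rw [coeff_signMap, map_neg, RingHom.coe_coe, (hu i n).2.2, ← mul_assoc, h, neg_one_mul]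

theorem IsFrame.lie_mem (hu : W.IsFrame u) (i : ι) {f : R⟦X⟧} (hf : f ∈ W.seriesSubring) :
    ⁅u i, f⁆ ∈ W.seriesSubring := by
  obtain ⟨g, hg, h⟩ := hu.exists_eq i
  rw [h, add_lie, X_pow_mul_lie]
  exact add_mem (W.X_pow_mul_mem_seriesSubring (W.lie_C_nabla_mem hf i) 1)
    (W.lie_mem_seriesSubring hg hf)

theorem IsFrame.lie_lie_mem (hu : W.IsFrame u) (i j : ι) : ⁅u i, u j⁆ ∈ W.seriesSubring := by
  obtain ⟨g, hg, h⟩ := hu.exists_eq j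
  rw [h, lie_add, lie_X_pow_mul]
  refine add_mem (W.X_pow_mul_mem_seriesSubring ?_ 1) (hu.lie_mem i hg)
  obtain ⟨g', hg', h'⟩ := hu.exists_eq i
  rw [h', add_lie, X_pow_mul_lie, ← lie_skew g']
  refine add_mem (W.X_pow_mul_mem_seriesSubring (fun n => ?_) 1)
    (neg_mem (W.lie_C_nabla_mem hg' j))
  rw [coeff_lie_C, coeff_C]
  split_ifs
  · rw [W.lie_nabla_nabla]
    exact zero_mem _
  · rw [lie_zero]
    exact zero_mem _

theorem IsFrame.lie_C_scal (hu : W.IsFrame u) (i : ι) (c : K) :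
    ⁅u i, C (W.scal c)⁆ = X ^ 1 * C (W.scal (W.d i c)) := by
  obtain ⟨g, hg, h⟩ := hu.exists_eq i
  rw [h, add_lie, W.lie_C_scal hg, add_zero, X_pow_mul_lie, ← W.lie_nabla_scal, Ring.map_lie]

variable (W) in
theorem omega_skew (i j : ι) : W.scal (W.omega i j) = -W.scal (W.omega j i) := by
  rw [← W.lie_e, ← W.lie_e, lie_skew]

variable (W) in
theorem omega_self (i : ι) : W.scal (W.omega i i) = 0 := by
  rw [← W.lie_e, lie_self]

variable (W) in
/-- Averaging over the parity automorphism. -/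
def parityPart (N : ℕ) (r : R) : R := (2 : k)⁻¹ • (r + (-1) ^ N * W.theta r)

theorem parityPart_mem {N : ℕ} {r : R} (hr : r ∈ W.S) : W.parityPart N r ∈ W.S :=
  W.S.smul_mem (add_mem hr (mul_mem (pow_mem (neg_mem (one_mem _)) _) (W.theta_mem r hr))) _

theorem theta_parityPart (N : ℕ) (r : R) :
    W.theta (W.parityPart N r) = (-1) ^ N * W.parityPart N r := by
  rw [parityPart, map_smul, map_add, map_mul, W.theta_theta, map_pow, map_neg, map_one,
    mul_smul_comm, mul_add, ← mul_assoc ((-1) ^ N), Ring.neg_one_pow_mul_self, one_mul, add_comm]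

theorem lie_e_parityPart (N : ℕ) (i : ι) (r : R) :
    ⁅W.e i, W.parityPart N r⁆ = W.parityPart (N + 1) ⁅W.e i, r⁆ := by
  have h : ∀ s : R, ⁅W.e i, (-1) ^ N * s⁆ = (-1) ^ N * ⁅W.e i, s⁆ := by
    intro s
    rcases neg_one_pow_eq_or R N with h | h <;> simp [h]
  have h' := Ring.map_lie (W.theta : R →+* R) (W.e i) r
  simp only [RingHom.coe_coe, W.theta_e, neg_lie] at h'
  rw [parityPart, parityPart, Ring.lie_smul, lie_add, h, h', pow_succ, mul_neg_one, neg_mul_neg]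

theorem parityPart_eq_self [CharZero k] {N : ℕ} {r : R} (h : W.theta r = (-1) ^ N * r) :
    W.parityPart N r = r := by
  rw [parityPart, h, ← mul_assoc, Ring.neg_one_pow_mul_self, one_mul, ← two_smul k r,
    smul_smul, inv_mul_cancel₀ two_ne_zero, one_smul]

theorem parityPart_sub (N : ℕ) (r s : R) :
    W.parityPart N (r - s) = W.parityPart N r - W.parityPart N s := by
  simp only [parityPart, map_sub, mul_sub, smul_sub, smul_add]
  abel

theorem IsFrame.add {N : ℕ} {ρ : ι → R} (hu : W.IsFrame u) (hρ : ∀ i, ρ i ∈ W.S)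
    (hθ : ∀ i, W.theta (ρ i) = (-1) ^ N * ρ i) :
    W.IsFrame fun i => u i + X ^ (N + 1) * C (ρ i) := by
  intro i n
  obtain ⟨h0, h1, h2⟩ := hu i n
  have hc : coeff n (u i + X ^ (N + 1) * C (ρ i)) =
      coeff n (u i) + if n = N + 1 then ρ i else 0 := by
    rw [map_add, coeff_X_pow_mul', coeff_C]
    congr 1
    rcases lt_trichotomy n (N + 1) with h | h | h
    · simp [not_le.2 h, h.ne]
    · simp [h]
    · rw [if_pos h.le, if_neg (Nat.sub_ne_zero_of_lt h), if_neg h.ne']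
  rw [hc]
  split_ifs with h
  · subst h
    refine ⟨fun h => absurd h N.succ_ne_zero, ?_, ?_⟩
    · rw [add_sub_right_comm]
      exact add_mem h1 (hρ i)
    · rw [map_add, h2, hθ, mul_add]
      congr 2
      rw [pow_add _ N 2]
      simp
  · rw [add_zero]
    exact ⟨h0, h1, h2⟩

/-- One step of the construction of a flat frame: by the Jacobi identity the leading term of the
error `⁅u i, u j⁆ - omega i j` is a closed `2`-form with values in the Weyl algebra, and a
primitive of it corrects the frame. -/
theorem IsFrame.step [CharZero k] [Fintype ι] (hu : W.IsFrame u) (N : ℕ)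
    (hE : ∀ i j, X ^ (N + 1) ∣ ⁅u i, u j⁆ - C (W.scal (W.omega i j))) :
    ∃ v, W.IsFrame v ∧ (∀ i j, X ^ (N + 2) ∣ ⁅v i, v j⁆ - C (W.scal (W.omega i j))) ∧
      ∀ i, X ^ (N + 1) ∣ v i - u i := by
  choose F hF using hE
  have hF0 : ∀ i j, PowerSeries.constantCoeff (F i j) =
      coeff (N + 1) (⁅u i, u j⁆ - C (W.scal (W.omega i j))) := by
    intro i j
    rw [hF, coeff_X_pow_mul', if_pos le_rfl, Nat.sub_self, coeff_zero_eq_constantCoeff_apply]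
  have hmem : ∀ i j, PowerSeries.constantCoeff (F i j) ∈ W.S := fun i j => by
    rw [hF0]
    exact sub_mem (hu.lie_lie_mem i j) (W.C_mem_seriesSubring (W.scal_mem _)) (N + 1)
  have hskew : ∀ i j, F i j = -F j i := by
    intro i j
    rw [eq_neg_iff_add_eq_zero]
    refine eq_zero_of_X_pow_mul_eq_zero (n := N + 1) ?_
    rw [mul_add, ← hF, ← hF, W.omega_skew i j, ← lie_skew, map_neg]
    abel
  have hself : ∀ i, F i i = 0 := by
    intro i
    refine eq_zero_of_X_pow_mul_eq_zero (n := N + 1) ?_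
    rw [← hF, W.omega_self, lie_self, map_zero, sub_zero]
  have hclosed : ∀ i j l, ⁅u i, F j l⁆ + ⁅u j, F l i⁆ + ⁅u l, F i j⁆ = 0 := by
    intro i j l
    refine eq_zero_of_X_pow_mul_eq_zero (n := N + 1) ?_
    rw [mul_add, mul_add, ← lie_X_pow_mul, ← lie_X_pow_mul, ← lie_X_pow_mul, ← hF, ← hF, ← hF,
      lie_sub, lie_sub, lie_sub, hu.lie_C_scal, hu.lie_C_scal, hu.lie_C_scal]
    have h1 := lie_jacobi (u i) (u j) (u l)
    have h2 := congrArg (fun c => X ^ 1 * C (W.scal c)) (W.omega_closed i j l)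
    simp only [map_add, mul_add, map_zero, mul_zero] at h2
    rw [← sub_eq_zero_of_eq (h1.trans h2.symm)]
    abel
  have hparity : ∀ i j, W.theta (PowerSeries.constantCoeff (F i j)) =
      (-1) ^ (N + 1) * PowerSeries.constantCoeff (F i j) := by
    intro i j
    have h : signMap (W.theta : R →+* R) (⁅u i, u j⁆ - C (W.scal (W.omega i j))) =
        ⁅u i, u j⁆ - C (W.scal (W.omega i j)) := by
      rw [map_sub, Ring.map_lie, hu.signMap_eq, hu.signMap_eq, neg_lie, lie_neg, neg_neg]
      congr 1
      ext n
      rw [coeff_signMap, coeff_C]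
      split_ifs with h <;> simp [h, W.theta_scal]
    have h' := congrArg (coeff (N + 1)) h
    rw [coeff_signMap, ← hF0, RingHom.coe_coe] at h'
    nth_rw 2 [← h']
    rw [← mul_assoc, Ring.neg_one_pow_mul_self, one_mul]
  obtain ⟨ρ, hρ, hρF⟩ := W.exists_primitive_two Finset.univ
    (fun i j => -PowerSeries.constantCoeff (F i j)) (fun i j => neg_mem (hmem i j))
    (fun i => by rw [hself, map_zero, neg_zero])
    (fun i j => by rw [hskew, map_neg])
    (fun i j l => by
      have h := congrArg PowerSeries.constantCoeff (hclosed i j l)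
      simp only [map_add, map_zero, constantCoeff_lie, hu.constantCoeff] at h
      simp only [lie_neg]
      rw [← neg_eq_zero, ← h]
      abel)
  refine ⟨fun i => u i + X ^ (N + 1) * C (W.parityPart N (ρ i)),
    hu.add (fun i => parityPart_mem (hρ i)) (fun i => theta_parityPart N (ρ i)), ?_, ?_⟩
  · intro i j
    change X ^ (N + 1 + 1) ∣ ⁅u i + X ^ (N + 1) * C (W.parityPart N (ρ i)),
      u j + X ^ (N + 1) * C (W.parityPart N (ρ j))⁆ - C (W.scal (W.omega i j))
    have key : ⁅W.e i, W.parityPart N (ρ j)⁆ - ⁅W.e j, W.parityPart N (ρ i)⁆ =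
        -PowerSeries.constantCoeff (F i j) := by
      rw [lie_e_parityPart, lie_e_parityPart, ← parityPart_sub,
        hρF i (Finset.mem_univ i) j (Finset.mem_univ j), parityPart_eq_self]
      rw [map_neg, hparity, mul_neg]
    generalize W.parityPart N (ρ i) = a at key ⊢
    generalize W.parityPart N (ρ j) = b at key ⊢
    have h : ⁅u i + X ^ (N + 1) * C a, u j + X ^ (N + 1) * C b⁆ - C (W.scal (W.omega i j)) =
        X ^ (N + 1) * (F i j + ⁅u i, C b⁆ - ⁅u j, C a⁆ + X ^ (N + 1) * ⁅C a, C b⁆) := by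
      rw [add_lie, lie_add, lie_add, X_pow_mul_lie, X_pow_mul_lie, lie_X_pow_mul, lie_X_pow_mul,
        mul_add, mul_sub, mul_add, ← hF, ← lie_skew (u j)]
      rw [mul_neg, sub_neg_eq_add]
      abel
    rw [h, pow_succ X (N + 1)]
    refine mul_dvd_mul_left _ (X_dvd_iff.2 ?_)
    rw [map_add, map_sub, map_add, constantCoeff_lie, constantCoeff_lie, hu.constantCoeff,
      hu.constantCoeff, constantCoeff_C, constantCoeff_C, add_sub_assoc, key]
    simp
  · intro i
    rw [add_sub_cancel_left]
    exact dvd_mul_right _ _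

theorem dvd_lie_sub_lie {N : ℕ} {f f' g g' : R⟦X⟧} (hf : X ^ N ∣ f' - f) (hg : X ^ N ∣ g' - g) :
    X ^ N ∣ ⁅f', g'⁆ - ⁅f, g⁆ := by
  obtain ⟨a, ha⟩ := hf
  obtain ⟨b, hb⟩ := hg
  refine ⟨⁅a, g'⁆ + ⁅f, b⁆, ?_⟩
  rw [mul_add, ← X_pow_mul_lie, ← lie_X_pow_mul, ← ha, ← hb, sub_lie, lie_sub]
  abel

variable (W) in
/-- The generators of the Weyl algebra deform to a frame with the same commutators: a flat
connection whose curvature is central. -/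
theorem exists_frame [CharZero k] [Fintype ι] : ∃ u : ι → R⟦X⟧, W.IsFrame u ∧
    ∀ i j, ⁅u i, u j⁆ = C (W.scal (W.omega i j)) := by
  obtain ⟨u, hu, hE⟩ := exists_limit W.IsFrameCoeff
    (fun N u => ∀ i j, X ^ (N + 1) ∣ ⁅u i, u j⁆ - C (W.scal (W.omega i j)))
    (fun i => C (W.e i) + X ^ 1 * C (W.nabla i)) (fun i n => by
      rw [map_add, coeff_X_pow_mul', coeff_C, coeff_C]
      rcases n with _ | _ | n
      · simpa [IsFrameCoeff, W.theta_e] using W.e_mem i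
      · simp [IsFrameCoeff, W.theta_nabla]
      · simp [IsFrameCoeff]) (fun i j => by
      rw [zero_add, pow_one]
      refine X_dvd_iff.2 ?_
      rw [map_sub, constantCoeff_lie]
      simp [W.lie_e])
    (fun N u hu hE => IsFrame.step hu N hE)
    (fun N u v hE h i j => by
      rw [← sub_add_sub_cancel _ ⁅u i, u j⁆]
      exact dvd_add (dvd_lie_sub_lie (h i) (h j)) (hE i j))
  exact ⟨u, hu, fun i j => sub_eq_zero.1 (eq_zero_of_forall_X_pow_dvd fun N => hE N i j)⟩

end FedosovData

/-! ### Flat sections -/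

namespace FedosovData

section

variable {k K R ι : Type*} [Field k] [CommRing K] [Algebra k K] [Ring R]
    [Algebra k R] [DecidableEq ι] {W : FedosovData k K R ι} {u : ι → R⟦X⟧}

/-- One step of the construction of a flat section: the leading term of `⁅u i, c⁆` is a closed
`1`-form with values in the Weyl algebra, and a primitive of it corrects `c`. -/
theorem IsFrame.step_section [CharZero k] [Fintype ι] (hu : W.IsFrame u)
    (hflat : ∀ i j, ⁅u i, u j⁆ = C (W.scal (W.omega i j))) (N : ℕ) {c : R⟦X⟧}
    (hc : c ∈ W.seriesSubring) (hE : ∀ i, X ^ (N + 1) ∣ ⁅u i, c⁆) :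
    ∃ r ∈ W.S, W.sig r = 0 ∧ ∀ i, X ^ (N + 2) ∣ ⁅u i, c + X ^ (N + 1) * C r⁆ := by
  choose F hF using hE
  have hmem : ∀ i, PowerSeries.constantCoeff (F i) ∈ W.S := fun i => by
    have h := hu.lie_mem i hc (N + 1)
    rwa [hF, coeff_X_pow_mul', if_pos le_rfl, Nat.sub_self, coeff_zero_eq_constantCoeff_apply] at h
  have hclosed : ∀ i j, ⁅u i, F j⁆ = ⁅u j, F i⁆ := by
    intro i j
    rw [← sub_eq_zero]
    refine eq_zero_of_X_pow_mul_eq_zero (n := N + 1) ?_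
    rw [mul_sub, ← lie_X_pow_mul, ← lie_X_pow_mul, ← hF, ← hF, ← lie_lie, hflat, ← lie_skew,
      W.lie_C_scal hc, neg_zero]
  obtain ⟨r, hr, hrF⟩ := W.exists_primitive_one Finset.univ
    (fun i => -PowerSeries.constantCoeff (F i)) (fun i => neg_mem (hmem i)) (fun i _ j _ => by
      have h := congrArg PowerSeries.constantCoeff (hclosed i j)
      rw [constantCoeff_lie, constantCoeff_lie, hu.constantCoeff, hu.constantCoeff] at h
      rw [lie_neg, lie_neg, h])
  refine ⟨r - W.scal (W.sig r), sub_mem hr (W.scal_mem _), ?_, fun i => ?_⟩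
  · rw [map_sub, W.sig_scal, sub_self]
  · rw [lie_add, lie_X_pow_mul, hF, ← mul_add, pow_succ X (N + 1)]
    refine mul_dvd_mul_left _ (X_dvd_iff.2 ?_)
    rw [map_add, constantCoeff_lie, hu.constantCoeff, constantCoeff_C, lie_sub, W.lie_e_scal,
      hrF i (Finset.mem_univ i), sub_zero, add_neg_cancel]

/-- Flat sections exist with any prescribed symbol. -/
theorem IsFrame.exists_section [CharZero k] [Fintype ι] (hu : W.IsFrame u)
    (hflat : ∀ i j, ⁅u i, u j⁆ = C (W.scal (W.omega i j))) (a : K⟦X⟧) :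
    ∃ c ∈ W.seriesSubring, (∀ i, ⁅u i, c⁆ = 0) ∧ ∀ n, W.sig (coeff n c) = coeff n a := by
  obtain ⟨c, hc, hE⟩ := exists_limit (ι := Unit) (fun _ n r => r ∈ W.S ∧ W.sig r = coeff n a)
    (fun N c => ∀ i, X ^ (N + 1) ∣ ⁅u i, c ()⁆) (fun _ => PowerSeries.map (W.scal : K →+* R) a)
    (fun _ n => by
      rw [coeff_map]
      exact ⟨W.scal_mem _, W.sig_scal _⟩)
    (fun i => by
      rw [zero_add, pow_one]
      refine X_dvd_iff.2 ?_
      rw [constantCoeff_lie, hu.constantCoeff,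
        ← coeff_zero_eq_constantCoeff_apply (PowerSeries.map _ a), coeff_map]
      exact W.lie_e_scal i _)
    (fun N c hc hE => by
      obtain ⟨r, hr, hr0, hE'⟩ := hu.step_section hflat N (fun n => (hc () n).1) hE
      refine ⟨fun _ => c () + X ^ (N + 1) * C r, fun _ n => ?_, hE', fun _ => ?_⟩
      · rw [map_add, coeff_X_pow_mul', coeff_C]
        obtain ⟨h1, h2⟩ := hc () n
        split_ifs
        · exact ⟨add_mem h1 hr, by rw [map_add, h2, hr0, add_zero]⟩
        · rw [add_zero]
          exact ⟨h1, h2⟩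
        · rw [add_zero]
          exact ⟨h1, h2⟩
      · rw [add_sub_cancel_left]
        exact dvd_mul_right _ _)
    (fun N c c' hE h i => by
      rw [← sub_add_cancel ⁅u i, c' ()⁆ ⁅u i, c ()⁆]
      exact dvd_add (dvd_lie_sub_lie (by simp) (h ())) (hE i))
  exact ⟨c (), fun n => (hc () n).1, fun i => eq_zero_of_forall_X_pow_dvd fun N => hE N i,
    fun n => (hc () n).2⟩

/-- A flat section is determined by its symbol. -/
theorem IsFrame.section_eq_zero (hu : W.IsFrame u) {c : R⟦X⟧} (hc : c ∈ W.seriesSubring)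
    (h : ∀ i, ⁅u i, c⁆ = 0) (hs : ∀ n, W.sig (coeff n c) = 0) : c = 0 := by
  ext n
  induction n using Nat.strong_induction_on with
  | _ n ih =>
    obtain ⟨g, hg⟩ := X_pow_dvd_iff.2 ih
    have hg0 : coeff n c = PowerSeries.constantCoeff g := by
      rw [hg, coeff_X_pow_mul', if_pos le_rfl, Nat.sub_self, coeff_zero_eq_constantCoeff_apply]
    rw [W.eq_scal (coeff n c) (hc n) fun i => ?_, hs, map_zero, map_zero]
    have h0 : ⁅u i, g⁆ = 0 := eq_zero_of_X_pow_mul_eq_zero (n := n) (by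
      rw [← lie_X_pow_mul, ← hg, h])
    rw [hg0, ← hu.constantCoeff, ← constantCoeff_lie, h0, map_zero]

variable (W u) in
/-- The algebra of flat sections that are invariant under the parity automorphism combined with
`X ↦ -X`. This is the deformation of `K`, with deformation parameter `X ^ 2`. -/
def flatSubring : Subring R⟦X⟧ where
  carrier := {c | c ∈ W.seriesSubring ∧ (∀ i, ⁅u i, c⁆ = 0) ∧ signMap (W.theta : R →+* R) c = c}
  mul_mem' {f g} hf hg := ⟨mul_mem hf.1 hg.1, fun i => by
    rw [Ring.lie_mul, hf.2.1, hg.2.1, zero_mul, mul_zero, add_zero], by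
    rw [map_mul, hf.2.2, hg.2.2]⟩
  one_mem' := ⟨one_mem _, fun i => by simp [Ring.lie_def], map_one _⟩
  add_mem' {f g} hf hg := ⟨add_mem hf.1 hg.1, fun i => by
    rw [lie_add, hf.2.1, hg.2.1, add_zero], by rw [map_add, hf.2.2, hg.2.2]⟩
  zero_mem' := ⟨zero_mem _, fun i => lie_zero _, map_zero _⟩
  neg_mem' {f} hf := ⟨neg_mem hf.1, fun i => by rw [lie_neg, hf.2.1, neg_zero], by
    rw [map_neg, hf.2.2]⟩

theorem map_algebraMap_comm (f : k⟦X⟧) (g : R⟦X⟧) :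
    PowerSeries.map (algebraMap k R) f * g = g * PowerSeries.map (algebraMap k R) f := by
  ext n
  rw [coeff_mul, coeff_mul, ← Finset.Nat.sum_antidiagonal_swap]
  refine Finset.sum_congr rfl fun p _ => ?_
  rw [coeff_map]
  exact Algebra.commutes _ _

variable (W u) in
/-- The central embedding `f(ħ) ↦ f(X ^ 2)` into the algebra of flat sections. -/
noncomputable def ofScalarSeries : k⟦X⟧ →+* W.flatSubring u :=
  ((PowerSeries.map (algebraMap k R)).comp
    (PowerSeries.expand 2 two_ne_zero : k⟦X⟧ →ₐ[k] k⟦X⟧).toRingHom).codRestrict _ fun f =>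
      ⟨fun n => by
        simp only [AlgHom.toRingHom_eq_coe, RingHom.comp_apply, RingHom.coe_coe, coeff_map]
        exact W.S.algebraMap_mem _,
      fun i => by
        rw [Ring.lie_def, sub_eq_zero]
        exact (map_algebraMap_comm _ _).symm,
      by
        ext n
        simp only [AlgHom.toRingHom_eq_coe, RingHom.comp_apply, RingHom.coe_coe, coeff_signMap,
          coeff_map, AlgHom.commutes, coeff_expand]
        split_ifs with h
        · rw [Even.neg_one_pow (even_iff_two_dvd.2 h), one_mul]
        · rw [map_zero, mul_zero]⟩

theorem coe_ofScalarSeries (f : k⟦X⟧) : (W.ofScalarSeries u f : R⟦X⟧) =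
    PowerSeries.map (algebraMap k R) (PowerSeries.expand 2 two_ne_zero f) := rfl

variable (W u) in
/-- The algebra of flat sections as an algebra over `k⟦ħ⟧`, with `ħ = X ^ 2`. -/
noncomputable abbrev flatAlgebra : Algebra k⟦X⟧ (W.flatSubring u) :=
  (W.ofScalarSeries u).toAlgebra' fun _ _ => Subtype.ext (map_algebraMap_comm _ _)

variable (W) in
/-- The symbol of a series, taken coefficientwise. -/
noncomputable def symbolSeries (c : R⟦X⟧) : K⟦X⟧ := PowerSeries.mk fun n => W.sig (coeff n c)

theorem coeff_symbolSeries (c : R⟦X⟧) (n : ℕ) : coeff n (W.symbolSeries c) = W.sig (coeff n c) :=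
  coeff_mk n fun n => W.sig (coeff n c)

theorem symbolSeries_map_mul (f : k⟦X⟧) (c : R⟦X⟧) :
    W.symbolSeries (PowerSeries.map (algebraMap k R) f * c) =
      PowerSeries.map (algebraMap k K) f * W.symbolSeries c := by
  ext n
  rw [coeff_symbolSeries, coeff_mul, coeff_mul, map_sum]
  refine Finset.sum_congr rfl fun p _ => ?_
  rw [coeff_map, coeff_map, coeff_symbolSeries, ← Algebra.smul_def, map_smul, Algebra.smul_def]

theorem sig_coeff_odd [CharZero k] {c : R⟦X⟧} (hc : signMap (W.theta : R →+* R) c = c) {n : ℕ}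
    (hn : ¬ 2 ∣ n) : W.sig (coeff n c) = 0 := by
  have h := congrArg W.sig (congrArg (coeff n) hc)
  rw [coeff_signMap, Odd.neg_one_pow (Nat.not_even_iff_odd.1 fun h => hn (even_iff_two_dvd.1 h)),
    neg_one_mul, map_neg, RingHom.coe_coe, W.sig_theta] at h
  have h2 : (2 : k) • W.sig (coeff n c) = 0 := by
    rw [two_smul]
    nth_rw 1 [← h]
    exact neg_add_cancel _
  rwa [smul_eq_zero_iff_right two_ne_zero] at h2

/-- The symbol of a flat section, as a power series in `ħ = X ^ 2`. -/
noncomputable def flatSymbol (c : W.flatSubring u) : K⟦X⟧ :=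
  PowerSeries.mk fun n => W.sig (coeff (2 * n) (c : R⟦X⟧))

theorem coeff_flatSymbol (c : W.flatSubring u) (n : ℕ) :
    coeff n (flatSymbol c) = W.sig (coeff (2 * n) (c : R⟦X⟧)) :=
  coeff_mk n fun n => W.sig (coeff (2 * n) (c : R⟦X⟧))

theorem expand_flatSymbol [CharZero k] (c : W.flatSubring u) :
    PowerSeries.expand 2 two_ne_zero (flatSymbol c) = W.symbolSeries (c : R⟦X⟧) := by
  ext n
  rw [coeff_symbolSeries, coeff_expand]
  split_ifs with h
  · rw [coeff_flatSymbol, Nat.mul_div_cancel' h]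
  · exact (sig_coeff_odd c.2.2.2 h).symm

theorem expand_two_injective {A : Type*} [CommRing A] :
    Function.Injective (PowerSeries.expand 2 two_ne_zero : A⟦X⟧ →ₐ[A] A⟦X⟧) := by
  intro f g h
  ext n
  rw [← coeff_expand_mul 2 two_ne_zero f, h, coeff_expand_mul]

/-- The flat sections are a copy of `K⟦ħ⟧`, by the symbol map. -/
theorem IsFrame.flatSymbol_bijective [CharZero k] [Fintype ι] (hu : W.IsFrame u)
    (hflat : ∀ i j, ⁅u i, u j⁆ = C (W.scal (W.omega i j))) :
    Function.Bijective (flatSymbol : W.flatSubring u → K⟦X⟧) := by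
  have inj : ∀ c c' : R⟦X⟧, c ∈ W.seriesSubring → c' ∈ W.seriesSubring → (∀ i, ⁅u i, c⁆ = 0) →
      (∀ i, ⁅u i, c'⁆ = 0) → (∀ n, W.sig (coeff n c) = W.sig (coeff n c')) → c = c' := by
    intro c c' hc hc' h h' hs
    refine sub_eq_zero.1 (hu.section_eq_zero (sub_mem hc hc') (fun i => ?_) fun n => ?_)
    · rw [lie_sub, h, h', sub_zero]
    · rw [map_sub, map_sub, hs, sub_self]
  constructor
  · intro c c' h
    refine Subtype.ext (inj _ _ c.2.1 c'.2.1 c.2.2.1 c'.2.2.1 fun n => ?_)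
    rw [← coeff_symbolSeries, ← coeff_symbolSeries, ← expand_flatSymbol, ← expand_flatSymbol, h]
  · intro a
    obtain ⟨c, hc, hc0, hca⟩ := hu.exists_section hflat (PowerSeries.expand 2 two_ne_zero a)
    -- The parity automorphism maps the section to another one with the same symbol, as the symbol
    -- is even in `X`.
    have hinv : signMap (W.theta : R →+* R) c = c := by
      refine inj _ _ (fun n => ?_) hc (fun i => ?_) hc0 fun n => ?_
      · rw [coeff_signMap]
        exact mul_mem (pow_mem (neg_mem (one_mem _)) _) (W.theta_mem _ (hc n))
      · rw [← neg_eq_zero, ← neg_lie, ← hu.signMap_eq, ← Ring.map_lie, hc0, map_zero]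
      · rw [coeff_signMap, RingHom.coe_coe]
        by_cases h : 2 ∣ n
        · rw [Even.neg_one_pow (even_iff_two_dvd.2 h), one_mul, W.sig_theta]
        · rw [Odd.neg_one_pow (Nat.not_even_iff_odd.1 fun h' => h (even_iff_two_dvd.1 h')),
            neg_one_mul, map_neg, W.sig_theta, hca, coeff_expand_of_not_dvd _ _ _ h, neg_zero]
    refine ⟨⟨c, hc, hc0, hinv⟩, ?_⟩
    ext n
    rw [coeff_flatSymbol, hca, coeff_expand_mul]

/-- To order zero, a flat section is its symbol. -/
theorem IsFrame.coeff_zero_eq (hu : W.IsFrame u) {c : R⟦X⟧} (hc : c ∈ W.flatSubring u) :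
    coeff 0 c = W.scal (W.sig (coeff 0 c)) := by
  refine W.eq_scal _ (hc.1 0) fun i => ?_
  rw [coeff_zero_eq_constantCoeff_apply, ← hu.constantCoeff, ← constantCoeff_lie, hc.2.1, map_zero]

/-- To first order, the flat section with symbol `a` is the Taylor expansion
`a - ∑ i, d i a * x i`. -/
theorem IsFrame.coeff_one_eq [CharZero k] [Fintype ι] (hu : W.IsFrame u) {c : R⟦X⟧}
    (hc : c ∈ W.flatSubring u) :
    coeff 1 c = -∑ i, W.scal (W.d i (W.sig (coeff 0 c))) * W.x i := by
  set a := W.sig (coeff 0 c)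
  have ha : coeff 0 c = W.scal a := hu.coeff_zero_eq hc
  set s := ∑ i, W.scal (W.d i a) * W.x i
  have hs : s ∈ W.S := sum_mem fun i _ => mul_mem (W.scal_mem _) (W.x_mem i)
  have hsig : W.sig (coeff 1 c + s) = 0 := by
    rw [map_add, sig_coeff_odd hc.2.2 (by decide), zero_add, map_sum]
    exact Finset.sum_eq_zero fun i _ => by rw [W.sig_scal_mul, W.sig_x, mul_zero]
  have hes : ∀ i, ⁅W.e i, s⁆ = W.scal (W.d i a) := by
    intro i
    rw [lie_sum, Finset.sum_eq_single i]
    · rw [Ring.lie_mul, W.lie_e_scal, W.lie_e_x, if_pos rfl, zero_mul, zero_add, mul_one]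
    · intro j _ hj
      rw [Ring.lie_mul, W.lie_e_scal, W.lie_e_x, if_neg hj.symm, zero_mul, zero_add, mul_zero]
    · exact fun h => absurd (Finset.mem_univ i) h
  have hec : ∀ i, ⁅W.e i, coeff 1 c⁆ = -W.scal (W.d i a) := by
    intro i
    obtain ⟨g, hg, h⟩ := hu.exists_eq i
    have h0 : coeff 0 (u i) = W.e i := (hu i 0).1 rfl
    have h1 : coeff 1 (u i) = W.nabla i + coeff 1 g := by
      rw [h, map_add, coeff_X_pow_mul']
      simp
    have hl := congrArg (coeff 1) (hc.2.1 i)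
    rw [Ring.lie_def, map_sub, coeff_one_mul', coeff_one_mul', map_zero, h0, h1, ha] at hl
    have h2 := W.lie_nabla_scal i a
    have h3 := W.lie_scal a _ (hg 1)
    rw [Ring.lie_def] at h2 h3 ⊢
    rw [← h2, ← sub_eq_zero]
    refine Eq.trans ?_ ((congrArg₂ (· - ·) hl h3).trans (sub_zero 0))
    noncomm_ring
  have h := W.eq_scal _ (add_mem (hc.1 1) hs) fun i => by rw [lie_add, hec, hes, neg_add_cancel]
  rw [hsig, map_zero] at h
  exact eq_neg_of_add_eq_zero_left h

end

/-- The algebra of flat sections, a deformation of `K`. -/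
theorem exists_deformation {k : Type u} {K R : Type v} {ι : Type*} [Field k] [CharZero k]
    [CommRing K] [Algebra k K] [Ring R] [Algebra k R] [DecidableEq ι] [Fintype ι]
    (W : FedosovData k K R ι) : ∃ D : FormalDeformation k K, ∀ a b : K,
      coeff 1 (D.star a b) = ∑ i, ∑ j, W.d i a * W.d j b * W.sig (W.x i * W.x j) := by
  obtain ⟨u, hu, hflat⟩ := W.exists_frame
  let _ := W.flatAlgebra u
  let φ : W.flatSubring u →ₗ[k⟦X⟧] K⟦X⟧ :=
    { toFun := flatSymbol
      map_add' := fun c c' => by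
        ext n
        simp only [coeff_flatSymbol, map_add, Subring.coe_add]
      map_smul' := fun f c => by
        apply expand_two_injective
        rw [expand_flatSymbol, Algebra.smul_def, Subring.coe_mul]
        change W.symbolSeries ((W.ofScalarSeries u f : R⟦X⟧) * c) = _
        rw [coe_ofScalarSeries, symbolSeries_map_mul, ← expand_flatSymbol, RingHom.id_apply,
          Algebra.smul_def, map_mul, map_expand]
        rfl }
  have hφ : ∀ c n, coeff n (φ c) = W.sig (coeff (2 * n) (c : R⟦X⟧)) := coeff_flatSymbol
  let D : FormalDeformation k K :=
    { carrier := W.flatSubring u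
      toSeries := LinearEquiv.ofBijective φ (hu.flatSymbol_bijective hflat)
      constantCoeff_one := by
        rw [LinearEquiv.ofBijective_apply, ← coeff_zero_eq_constantCoeff_apply, hφ]
        simp [W.sig_one]
      constantCoeff_mul := fun c c' => by
        simp only [LinearEquiv.ofBijective_apply, ← coeff_zero_eq_constantCoeff_apply, hφ]
        rw [mul_zero, Subring.coe_mul, coeff_zero_mul', hu.coeff_zero_eq c.2, W.sig_scal_mul,
          W.sig_scal] }
  refine ⟨D, fun a b => ?_⟩
  have hD : ∀ (a : K) n, W.sig (coeff (2 * n) ((D.toSeries.symm (C a) : W.flatSubring u) : R⟦X⟧)) =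
      if n = 0 then a else 0 := by
    intro a n
    rw [← hφ, ← coeff_C]
    exact congrArg (coeff n) (D.toSeries.apply_symm_apply (C a))
  change coeff 1 (φ (D.toSeries.symm (C a) * D.toSeries.symm (C b))) = _
  have ha0 := hD a 0
  have ha2 := hD a 1
  have hb0 := hD b 0
  have hb2 := hD b 1
  generalize (D.toSeries.symm (C a) : W.flatSubring u) = c at ha0 ha2 ⊢
  generalize (D.toSeries.symm (C b) : W.flatSubring u) = c' at hb0 hb2 ⊢
  rw [mul_zero, if_pos rfl] at ha0 hb0
  rw [mul_one, if_neg one_ne_zero] at ha2 hb2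
  have hc0 := hu.coeff_zero_eq c.2
  have hc0' := hu.coeff_zero_eq c'.2
  have hc1 := hu.coeff_one_eq c.2
  have hc1' := hu.coeff_one_eq c'.2
  rw [ha0] at hc0 hc1
  rw [hb0] at hc0' hc1'
  have hcomm : ∀ r ∈ W.S, ∀ a, r * W.scal a = W.scal a * r := fun r hr a =>
    sub_eq_zero.1 (W.lie_scal a r hr)
  rw [hφ, Subring.coe_mul, mul_one, coeff_two_mul', hc0, hc0', hcomm _ (c.2.1 2), hc1, hc1',
    map_add, map_add, W.sig_scal_mul, W.sig_scal_mul, ha2, hb2, mul_zero, mul_zero, zero_add,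
    add_zero, neg_mul_neg, Finset.sum_mul_sum, map_sum]
  refine Finset.sum_congr rfl fun i _ => ?_
  rw [map_sum]
  refine Finset.sum_congr rfl fun j _ => ?_
  rw [mul_assoc, ← mul_assoc (W.x i), hcomm _ (W.x_mem i), mul_assoc, W.sig_scal_mul,
    W.sig_scal_mul, mul_assoc]

end FedosovData

end Fedosov

/-! ### Operators on polynomials -/

namespace WeylModel

open MvPolynomial

variable {k K ι : Type*} [Field k] [CommRing K] [Algebra k K]

variable (k) in
/-- Multiplication by a polynomial, as an operator on polynomials. -/
noncomputable def mulOp : MvPolynomial ι K →ₐ[k] Module.End k (MvPolynomial ι K) :=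
  Algebra.lmul k (MvPolynomial ι K)

@[simp]
theorem mulOp_apply (f g : MvPolynomial ι K) : mulOp k f g = f * g := rfl

variable (k ι) in
/-- Multiplication by a scalar of `K`, as an operator on polynomials. -/
noncomputable def scalOp : K →ₐ[k] Module.End k (MvPolynomial ι K) :=
  (mulOp k).comp (IsScalarTower.toAlgHom k K (MvPolynomial ι K))

theorem scalOp_eq (c : K) : scalOp k ι c = mulOp k (C c) := rfl

@[simp]
theorem scalOp_apply (c : K) (f : MvPolynomial ι K) : scalOp k ι c f = C c * f := rfl

variable (k) in
/-- A vector field, as an operator on polynomials. -/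
noncomputable def vecOp : Derivation K (MvPolynomial ι K) (MvPolynomial ι K) →ₗ[K]
    Module.End k (MvPolynomial ι K) where
  toFun D := (D : MvPolynomial ι K →ₗ[K] MvPolynomial ι K).restrictScalars k
  map_add' _ _ := rfl
  map_smul' _ _ := rfl

@[simp]
theorem vecOp_apply (D : Derivation K (MvPolynomial ι K) (MvPolynomial ι K))
    (f : MvPolynomial ι K) : vecOp k D f = D f := rfl

variable (ι) in
/-- A derivation of `K`, acting on the coefficients of polynomials. -/
noncomputable def coeffOp (d : Derivation k K K) : Module.End k (MvPolynomial ι K) :=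
  ((basisMonomials ι K).repr.symm.toLinearMap.restrictScalars k) ∘ₗ
    Finsupp.mapRange.linearMap (d : K →ₗ[k] K) ∘ₗ
    ((basisMonomials ι K).repr.toLinearMap.restrictScalars k)

@[simp]
theorem coeff_coeffOp (d : Derivation k K K) (f : MvPolynomial ι K) (s : ι →₀ ℕ) :
    coeff s (coeffOp ι d f) = d (coeff s f) := by
  have h : ∀ g : MvPolynomial ι K, coeff s g = (basisMonomials ι K).repr g s := fun g => rfl
  rw [h, h]
  change (basisMonomials ι K).repr ((basisMonomials ι K).repr.symm _) s = _
  rw [LinearEquiv.apply_symm_apply]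
  rfl

theorem lie_mulOp_mulOp (f g : MvPolynomial ι K) : ⁅mulOp k f, mulOp k g⁆ = 0 := by
  rw [Ring.lie_def, ← map_mul, ← map_mul, mul_comm, sub_self]

theorem lie_vecOp_mulOp (D : Derivation K (MvPolynomial ι K) (MvPolynomial ι K))
    (f : MvPolynomial ι K) : ⁅vecOp k D, mulOp k f⁆ = mulOp k (D f) := by
  refine LinearMap.ext fun g => ?_
  simp [Ring.lie_def, mul_comm g]

theorem lie_vecOp_scalOp (D : Derivation K (MvPolynomial ι K) (MvPolynomial ι K)) (c : K) :
    ⁅vecOp k D, scalOp k ι c⁆ = 0 := by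
  rw [scalOp_eq, lie_vecOp_mulOp, ← algebraMap_eq, Derivation.map_algebraMap, map_zero]

theorem lie_mulOp_scalOp (f : MvPolynomial ι K) (c : K) : ⁅mulOp k f, scalOp k ι c⁆ = 0 :=
  lie_mulOp_mulOp _ _

theorem lie_mulOp_vecOp (D : Derivation K (MvPolynomial ι K) (MvPolynomial ι K))
    (f : MvPolynomial ι K) : ⁅mulOp k f, vecOp k D⁆ = -mulOp k (D f) := by
  rw [← lie_skew, lie_vecOp_mulOp]

theorem lie_coeffOp_scalOp (d : Derivation k K K) (c : K) :
    ⁅coeffOp ι d, scalOp k ι c⁆ = scalOp k ι (d c) := by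
  refine LinearMap.ext fun f => ?_
  ext s
  simp [Ring.lie_def, coeff_C_mul, mul_comm (coeff s f)]

theorem lie_coeffOp_mulOp_X (d : Derivation k K K) (a : ι) :
    ⁅coeffOp ι d, mulOp k (X a : MvPolynomial ι K)⁆ = 0 := by
  classical
  refine LinearMap.ext fun f => ?_
  ext s
  simp only [Ring.lie_def, LinearMap.sub_apply, Module.End.mul_apply, mulOp_apply, coeff_sub,
    coeff_coeffOp, coeff_X_mul']
  split_ifs <;> simp

theorem lie_coeffOp_pderiv (d : Derivation k K K) (a : ι) :
    ⁅coeffOp ι d, vecOp k (pderiv a : Derivation K (MvPolynomial ι K) _)⁆ = 0 := by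
  refine LinearMap.ext fun f => ?_
  ext s
  have h : d ((s a : K) + 1) = 0 := by
    rw [map_add, Derivation.map_natCast, Derivation.map_one_eq_zero, add_zero]
  simp [Ring.lie_def, coeff_pderiv, h, mul_comm]

variable (K ι) in
/-- The reflection `x ↦ -x`. -/
noncomputable def reflect : MvPolynomial ι K →ₐ[K] MvPolynomial ι K := aeval fun a => -X a

theorem reflect_reflect (f : MvPolynomial ι K) : reflect K ι (reflect K ι f) = f := by
  have h : (reflect K ι).comp (reflect K ι) = AlgHom.id K _ := by
    ext a
    simp [reflect]
  exact DFunLike.congr_fun h f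

@[simp]
theorem reflect_X (a : ι) : reflect K ι (X a) = -X a := by simp [reflect]

@[simp]
theorem reflect_C (c : K) : reflect K ι (C c) = C c := by simp [reflect]

theorem constantCoeff_reflect (f : MvPolynomial ι K) :
    constantCoeff (reflect K ι f) = constantCoeff f := by
  induction f using MvPolynomial.induction_on with
  | C c => simp
  | add f g hf hg => simp [hf, hg]
  | mul_X f a hf => simp

theorem reflect_pderiv (a : ι) (f : MvPolynomial ι K) :
    reflect K ι (pderiv a f) = -pderiv a (reflect K ι f) := by
  classical
  induction f using MvPolynomial.induction_on with
  | C c => simp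
  | add f g hf hg => simp [hf, hg, add_comm]
  | mul_X f b hf =>
    rw [Derivation.leibniz, map_add, smul_eq_mul, smul_eq_mul, map_mul, map_mul, map_mul, hf,
      Derivation.leibniz, reflect_X, smul_eq_mul, smul_eq_mul, map_neg, pderiv_X, Pi.single_apply]
    split_ifs
    · simp
      ring
    · simp

theorem coeffOp_C (d : Derivation k K K) (c : K) :
    coeffOp ι d (C c) = C (d c) := by
  classical
  ext s
  simp only [coeff_coeffOp, coeff_C]
  split_ifs <;> simp

theorem reflect_coeffOp (d : Derivation k K K) (f : MvPolynomial ι K) :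
    reflect K ι (coeffOp ι d f) = coeffOp ι d (reflect K ι f) := by
  have hX : ∀ (g : MvPolynomial ι K) a, coeffOp ι d (g * X a) = coeffOp ι d g * X a := by
    intro g a
    have h := LinearMap.congr_fun (lie_coeffOp_mulOp_X d a) g
    rw [Ring.lie_def] at h
    simpa [sub_eq_zero, mul_comm] using h
  induction f using MvPolynomial.induction_on with
  | C c => simp [coeffOp_C]
  | add f g hf hg => simp [hf, hg]
  | mul_X f a hf => rw [hX, map_mul, map_mul, hf, reflect_X, mul_neg, mul_neg, map_neg, hX]

variable (k K ι) in
/-- Conjugation by the reflection `x ↦ -x`. -/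
noncomputable def parity :
    Module.End k (MvPolynomial ι K) →ₐ[k] Module.End k (MvPolynomial ι K) where
  toFun r := ((reflect K ι).toLinearMap.restrictScalars k) ∘ₗ r ∘ₗ
    ((reflect K ι).toLinearMap.restrictScalars k)
  map_one' := LinearMap.ext fun f => by simp [reflect_reflect]
  map_mul' r s := LinearMap.ext fun f => by simp [reflect_reflect]
  map_zero' := LinearMap.ext fun f => by simp
  map_add' r s := LinearMap.ext fun f => by simp
  commutes' c := LinearMap.ext fun f => by
    simp [Algebra.algebraMap_eq_smul_one, AlgHom.map_smul_of_tower, reflect_reflect]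

@[simp]
theorem parity_apply (r : Module.End k (MvPolynomial ι K)) (f : MvPolynomial ι K) :
    parity k K ι r f = reflect K ι (r (reflect K ι f)) := rfl

theorem parity_mulOp (f : MvPolynomial ι K) :
    parity k K ι (mulOp k f) = mulOp k (reflect K ι f) := by
  refine LinearMap.ext fun g => ?_
  simp [reflect_reflect]

theorem parity_parity (r : Module.End k (MvPolynomial ι K)) :
    parity k K ι (parity k K ι r) = r := by
  refine LinearMap.ext fun f => ?_
  simp [reflect_reflect]

theorem parity_scalOp (c : K) : parity k K ι (scalOp k ι c) = scalOp k ι c := by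
  rw [scalOp_eq, parity_mulOp, reflect_C]

variable (k K ι) in
/-- The symbol of an operator: the constant term of its value on the polynomial `1`. -/
noncomputable def symbol : Module.End k (MvPolynomial ι K) →ₗ[k] K where
  toFun r := constantCoeff (r 1)
  map_add' r s := by rw [LinearMap.add_apply, map_add]
  map_smul' c r := by
    rw [LinearMap.smul_apply, ← algebraMap_smul K c, smul_eq_C_mul, map_mul, constantCoeff_C,
      RingHom.id_apply, Algebra.smul_def]

theorem symbol_apply (r : Module.End k (MvPolynomial ι K)) :
    symbol k K ι r = constantCoeff (r 1) := rfl

variable [Fintype ι]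

/-- The vector field with constant coefficients `w`. -/
noncomputable def vec (w : ι → K) : Derivation K (MvPolynomial ι K) (MvPolynomial ι K) :=
  ∑ b, w b • pderiv b

theorem vec_apply (w : ι → K) (f : MvPolynomial ι K) : vec w f = ∑ b, w b • pderiv b f := by
  rw [vec, ← Derivation.coeFnAddMonoidHom_apply, map_sum, Finset.sum_apply]
  rfl

theorem vec_X (w : ι → K) (b : ι) : vec w (X b) = C (w b) := by
  classical
  rw [vec_apply, Finset.sum_eq_single b]
  · rw [pderiv_X_self, smul_eq_C_mul, mul_one]
  · intro c _ hc
    rw [pderiv_X_of_ne hc.symm, smul_zero]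
  · exact fun h => absurd (Finset.mem_univ b) h

theorem lie_vecOp_vec (w w' : ι → K) : ⁅vecOp k (vec w), vecOp k (vec w')⁆ = 0 := by
  have h : ⁅vec w, vec w'⁆ = 0 := by
    refine MvPolynomial.derivation_ext fun c => ?_
    rw [Derivation.commutator_apply, vec_X, vec_X]
    simp [← algebraMap_eq]
  refine LinearMap.ext fun f => ?_
  have h' := Derivation.congr_fun h f
  rw [Derivation.commutator_apply] at h'
  exact h'

theorem lie_coeffOp_vec (d : Derivation k K K) {w : ι → K} (hw : ∀ b, d (w b) = 0) :
    ⁅coeffOp ι d, vecOp k (vec w)⁆ = 0 := by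
  refine LinearMap.ext fun f => ?_
  have h : ∀ b, coeffOp ι d (pderiv b f) = pderiv b (coeffOp ι d f) := fun b =>
    sub_eq_zero.1 (LinearMap.congr_fun (lie_coeffOp_pderiv d b) f)
  have h' : ∀ b (g : MvPolynomial ι K), coeffOp ι d (w b • g) = w b • coeffOp ι d g := by
    intro b g
    ext s
    simp [hw]
  change coeffOp ι d (vec w f) - vec w (coeffOp ι d f) = 0
  simp only [vec_apply, map_sum, h', h, sub_self]

theorem parity_vec (w : ι → K) : parity k K ι (vecOp k (vec w)) = -vecOp k (vec w) := by
  refine LinearMap.ext fun f => ?_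
  simp only [parity_apply, vecOp_apply, LinearMap.neg_apply, vec_apply, map_sum, map_smul,
    reflect_pderiv, reflect_reflect, smul_neg, Finset.sum_neg_distrib]

/-- The linear form with coefficients `v`. -/
noncomputable def lin (v : ι → K) : MvPolynomial ι K := ∑ a, C (v a) * X a

theorem vec_lin (w v : ι → K) : vec w (lin v) = C (w ⬝ᵥ v) := by
  simp only [lin, map_sum, dotProduct]
  refine Finset.sum_congr rfl fun a _ => ?_
  rw [← smul_eq_C_mul, Derivation.map_smul, vec_X, smul_eq_C_mul, ← C_mul, mul_comm]

theorem vec_iterate_eq_zero (w : ι → K) (f : MvPolynomial ι K) : ∃ N, (vec w)^[N] f = 0 := by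
  have hz : ∀ n, (vec w)^[n] 0 = 0 := fun n => iterate_map_zero (vec w) n
  induction f using MvPolynomial.induction_on with
  | C c => exact ⟨1, by rw [Function.iterate_one, ← algebraMap_eq, Derivation.map_algebraMap]⟩
  | add f g hf hg =>
    obtain ⟨M, hM⟩ := hf
    obtain ⟨N, hN⟩ := hg
    refine ⟨M + N, ?_⟩
    rw [iterate_map_add, Function.iterate_add_apply _ M N g, hN, hz, add_comm M N,
      Function.iterate_add_apply, hM, hz, add_zero]
  | mul_X f a hf =>
    have hC : ∀ (n : ℕ) (c : K) (g : MvPolynomial ι K),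
        (vec w)^[n] (C c * g) = C c * (vec w)^[n] g := by
      intro n c g
      induction n with
      | zero => rfl
      | succ n ih =>
        rw [Function.iterate_succ_apply', Function.iterate_succ_apply', ih, ← smul_eq_C_mul,
          Derivation.map_smul, smul_eq_C_mul]
    obtain ⟨N, hN⟩ := hf
    refine ⟨N + 1, ?_⟩
    induction N generalizing f with
    | zero => rw [show f = 0 from hN, zero_mul, hz]
    | succ N ih =>
      rw [Function.iterate_succ_apply, Derivation.leibniz, vec_X, smul_eq_mul, smul_eq_mul,
        iterate_map_add, mul_comm f, hC, hN, mul_zero, zero_add, mul_comm (X a)]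
      exact ih _ (by rwa [← Function.iterate_succ_apply])

theorem eq_C_of_pderiv_eq_zero [CharZero k] {f : MvPolynomial ι K} (h : ∀ b, pderiv b f = 0) :
    f = C (constantCoeff f) := by
  classical
  ext s
  rw [coeff_C]
  split_ifs with hs
  · rw [← hs]
    rfl
  · obtain ⟨b, hb⟩ : ∃ b, s b ≠ 0 := by
      by_contra! h0
      exact hs (Finsupp.ext h0).symm
    have h1 := congrArg (coeff (s - Finsupp.single b 1)) (h b)
    have hle : Finsupp.single b 1 ≤ s := Finsupp.single_le_iff.2 (Nat.one_le_iff_ne_zero.2 hb)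
    rw [coeff_pderiv, tsub_add_cancel_of_le hle, coeff_zero] at h1
    have h2 : ((s - Finsupp.single b 1 : ι →₀ ℕ) b : K) + 1 = algebraMap k K (s b : k) := by
      rw [Finsupp.tsub_apply, Finsupp.single_eq_same, map_natCast, ← Nat.cast_succ,
        Nat.succ_eq_add_one, Nat.sub_add_cancel (Nat.one_le_iff_ne_zero.2 hb)]
    rw [h2, mul_comm, ← Algebra.smul_def,
      smul_eq_zero_iff_right (by exact_mod_cast hb : (s b : k) ≠ 0)] at h1
    exact h1

end WeylModel

/-! ### The Weyl algebra -/

namespace WeylModel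

open MvPolynomial
open scoped Matrix

variable {k K ι : Type*} [Field k] [CommRing K] [Algebra k K] [Fintype ι] (J : Matrix ι ι K)

variable (k) in
/-- The generator of the Weyl algebra that belongs to the linear form `v`, acting on polynomials by
left Moyal multiplication. -/
noncomputable def leftOp (v : ι → K) : Module.End k (MvPolynomial ι K) :=
  mulOp k (lin v) + vecOp k (vec (Matrix.vecMul v J))

variable (k) in
/-- Right Moyal multiplication by the coordinate `X a`. -/
noncomputable def rightOp (a : ι) : Module.End k (MvPolynomial ι K) :=
  mulOp k (X a) - vecOp k (vec (J a))

variable (k) in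
/-- The Weyl algebra: the operators that commute with the right Moyal multiplications. -/
noncomputable def weyl : Subalgebra k (Module.End k (MvPolynomial ι K)) :=
  Subalgebra.centralizer k (Set.range (scalOp k ι) ∪ Set.range (rightOp k J))

variable {J}

theorem mem_weyl {r : Module.End k (MvPolynomial ι K)} :
    r ∈ weyl k J ↔ (∀ c : K, ⁅r, scalOp k ι c⁆ = 0) ∧ ∀ a, ⁅r, rightOp k J a⁆ = 0 := by
  simp only [weyl, Subalgebra.mem_centralizer_iff, Set.mem_union, Set.mem_range, or_imp,
    forall_and, forall_exists_index, forall_apply_eq_imp_iff, Ring.lie_def, sub_eq_zero]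
  exact and_congr (forall_congr' fun _ => eq_comm) (forall_congr' fun _ => eq_comm)

theorem lie_vecOp_rightOp (w : ι → K) (a : ι) :
    ⁅vecOp k (vec w), rightOp k J a⁆ = scalOp k ι (w a) := by
  rw [rightOp, lie_sub, lie_vecOp_mulOp, lie_vecOp_vec, sub_zero, vec_X, scalOp_eq]

theorem scalOp_mem (c : K) : scalOp k ι c ∈ weyl k J := by
  refine mem_weyl.2 ⟨fun c' => lie_mulOp_mulOp _ _, fun a => ?_⟩
  rw [rightOp, lie_sub, ← lie_skew _ (vecOp k _), lie_vecOp_scalOp, neg_zero, sub_zero]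
  exact lie_mulOp_mulOp _ _

theorem vecMul_apply_eq (hJ : Jᵀ = -J) (v : ι → K) (a : ι) : Matrix.vecMul v J a = -(J a ⬝ᵥ v) := by
  have h : ∀ b, J b a = -J a b := fun b => congrFun (congrFun hJ a) b
  simp only [Matrix.vecMul, dotProduct, h, mul_neg, Finset.sum_neg_distrib, mul_comm]

theorem leftOp_mem (hJ : Jᵀ = -J) (v : ι → K) : leftOp k J v ∈ weyl k J := by
  refine mem_weyl.2 ⟨fun c => ?_, fun a => ?_⟩
  · rw [leftOp, add_lie, lie_mulOp_scalOp, lie_vecOp_scalOp, add_zero]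
  · rw [leftOp, add_lie, lie_vecOp_rightOp, rightOp, lie_sub, lie_mulOp_mulOp, lie_mulOp_vecOp,
      vec_lin, ← scalOp_eq, vecMul_apply_eq hJ, zero_sub, neg_neg, map_neg, add_neg_cancel]

theorem lie_leftOp_leftOp (hJ : Jᵀ = -J) (v w : ι → K) :
    ⁅leftOp k J v, leftOp k J w⁆ = scalOp k ι (2 * (Matrix.vecMul v J ⬝ᵥ w)) := by
  have h : Matrix.vecMul w J ⬝ᵥ v = -(Matrix.vecMul v J ⬝ᵥ w) := by
    rw [dotProduct_comm, ← Matrix.dotProduct_mulVec, ← Matrix.vecMul_transpose, hJ,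
      Matrix.vecMul_neg, dotProduct_neg, neg_neg]
  rw [leftOp, leftOp, add_lie, lie_add, lie_add, lie_mulOp_mulOp, lie_mulOp_vecOp,
    lie_vecOp_mulOp, lie_vecOp_vec, vec_lin, vec_lin, h, ← scalOp_eq, ← scalOp_eq, map_neg, neg_neg,
    zero_add, add_zero, ← map_add, two_mul]

theorem lie_scalOp_mul {r : Module.End k (MvPolynomial ι K)} (hr : r ∈ weyl k J) (c : K)
    (s : Module.End k (MvPolynomial ι K)) : ⁅r, scalOp k ι c * s⁆ = scalOp k ι c * ⁅r, s⁆ := by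
  rw [Ring.lie_mul, (mem_weyl.1 hr).1, zero_mul, zero_add]

theorem lie_mem_weyl {r s : Module.End k (MvPolynomial ι K)} (hr : r ∈ weyl k J)
    (hs : s ∈ weyl k J) : ⁅r, s⁆ ∈ weyl k J := by
  rw [Ring.lie_def]
  exact sub_mem (mul_mem hr hs) (mul_mem hs hr)

/-- The Weyl algebra is stable under the vector fields with constant coefficients. -/
theorem lie_vecOp_mem {r : Module.End k (MvPolynomial ι K)} (hr : r ∈ weyl k J) (w : ι → K) :
    ⁅vecOp k (vec w), r⁆ ∈ weyl k J := by
  obtain ⟨h1, h2⟩ := mem_weyl.1 hr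
  refine mem_weyl.2 ⟨fun c => ?_, fun a => ?_⟩
  · rw [lie_lie, h1, lie_zero, lie_vecOp_scalOp, lie_zero, sub_zero]
  · rw [lie_lie, h2, lie_zero, lie_vecOp_rightOp, h1, sub_zero]

/-- On the Weyl algebra the commutator with a generator is twice the commutator with a vector field,
because a left Moyal multiplication is a combination of right ones plus twice that field. -/
theorem lie_leftOp {r : Module.End k (MvPolynomial ι K)} (hr : r ∈ weyl k J) (v : ι → K) :
    ⁅leftOp k J v, r⁆ = (2 : Module.End k (MvPolynomial ι K)) *
      ⁅vecOp k (vec (Matrix.vecMul v J)), r⁆ := by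
  have h : leftOp k J v = ∑ a, scalOp k ι (v a) * rightOp k J a +
      (vecOp k (vec (Matrix.vecMul v J)) + vecOp k (vec (Matrix.vecMul v J))) := by
    refine LinearMap.ext fun f => ?_
    simp only [leftOp, rightOp, LinearMap.add_apply, LinearMap.sum_apply, Module.End.mul_apply,
      LinearMap.sub_apply, mulOp_apply, vecOp_apply, scalOp_apply, mul_sub, Finset.sum_sub_distrib,
      lin, Finset.sum_mul, mul_assoc]
    have h' : vec (Matrix.vecMul v J) f = ∑ a, C (v a) * vec (J a) f := by
      simp only [vec_apply, Finset.mul_sum, Matrix.vecMul, dotProduct, Finset.sum_smul]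
      rw [Finset.sum_comm]
      refine Finset.sum_congr rfl fun a _ => Finset.sum_congr rfl fun b _ => ?_
      rw [mul_smul, smul_eq_C_mul (_ • _)]
    rw [h']
    abel
  rw [h, add_lie, add_lie, ← lie_skew, lie_sum, Finset.sum_eq_zero, neg_zero, zero_add, two_mul]
  intro a _
  rw [lie_scalOp_mul hr, (mem_weyl.1 hr).2, mul_zero]

theorem lie_vecOp_one (r : Module.End k (MvPolynomial ι K)) (w : ι → K) :
    ⁅vecOp k (vec w), r⁆ 1 = vec w (r 1) := by
  rw [Ring.lie_def, LinearMap.sub_apply, Module.End.mul_apply, Module.End.mul_apply, vecOp_apply,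
    vecOp_apply, Derivation.map_one_eq_zero, map_zero, sub_zero]

/-- An element of the Weyl algebra is determined by its value on the polynomial `1`, since right
Moyal multiplications, with which it commutes, generate all polynomials from `1`. -/
theorem eq_zero_of_apply_one {r : Module.End k (MvPolynomial ι K)} (hr : r ∈ weyl k J)
    (h : r 1 = 0) : r = 0 := by
  refine LinearMap.ext fun f => ?_
  rw [LinearMap.zero_apply]
  induction f using MvPolynomial.induction_on generalizing r with
  | C c =>
    have h1 := LinearMap.congr_fun ((mem_weyl.1 hr).1 c) 1
    rw [Ring.lie_def] at h1
    simpa [h] using h1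
  | add f g hf hg => rw [map_add, hf hr h, hg hr h, add_zero]
  | mul_X f a hf =>
    have h1 : f * X a = rightOp k J a f + vec (J a) f := by
      simp [rightOp, mul_comm]
    have h2 := LinearMap.congr_fun ((mem_weyl.1 hr).2 a) f
    have h3 := hf (lie_vecOp_mem hr (J a)) (by rw [lie_vecOp_one, h, map_zero])
    rw [Ring.lie_def, LinearMap.sub_apply, Module.End.mul_apply, Module.End.mul_apply, hf hr h,
      map_zero] at h2 h3
    rw [h1, map_add]
    simpa [sub_eq_zero] using congrArg₂ (· - ·) h2 h3

theorem constantCoeff_lin (v : ι → K) : constantCoeff (lin v) = 0 := by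
  simp [lin]

theorem leftOp_one (v : ι → K) : leftOp k J v 1 = lin v := by
  simp [leftOp]

theorem symbol_leftOp_mul_leftOp (v w : ι → K) :
    symbol k K ι (leftOp k J v * leftOp k J w) = Matrix.vecMul v J ⬝ᵥ w := by
  rw [symbol_apply, Module.End.mul_apply, leftOp_one, leftOp, LinearMap.add_apply, mulOp_apply,
    vecOp_apply, vec_lin, map_add, map_mul, constantCoeff_lin, zero_mul, zero_add, constantCoeff_C]

theorem parity_leftOp (v : ι → K) : parity k K ι (leftOp k J v) = -leftOp k J v := by
  have h : reflect K ι (lin v) = -lin v := by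
    simp [lin]
  rw [leftOp, map_add, parity_mulOp, parity_vec, h, map_neg, neg_add]

theorem parity_rightOp (a : ι) : parity k K ι (rightOp k J a) = -rightOp k J a := by
  rw [rightOp, map_sub, parity_mulOp, parity_vec, reflect_X, map_neg]
  abel

theorem parity_mem {r : Module.End k (MvPolynomial ι K)} (hr : r ∈ weyl k J) :
    parity k K ι r ∈ weyl k J := by
  obtain ⟨h1, h2⟩ := mem_weyl.1 hr
  have hl := Ring.map_lie
    (parity k K ι : Module.End k (MvPolynomial ι K) →+* Module.End k (MvPolynomial ι K)) r
  simp only [RingHom.coe_coe] at hl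
  refine mem_weyl.2 ⟨fun c => ?_, fun a => ?_⟩
  · rw [← parity_scalOp, ← hl, h1, map_zero]
  · rw [← neg_eq_zero, ← lie_neg, ← parity_rightOp, ← hl, h2, map_zero]

theorem lie_coeffOp_mem (d : Derivation k K K) (hd : ∀ a b, d (J a b) = 0)
    {r : Module.End k (MvPolynomial ι K)} (hr : r ∈ weyl k J) : ⁅coeffOp ι d, r⁆ ∈ weyl k J := by
  obtain ⟨h1, h2⟩ := mem_weyl.1 hr
  refine mem_weyl.2 ⟨fun c => ?_, fun a => ?_⟩
  · rw [lie_lie, h1, lie_zero, lie_coeffOp_scalOp, h1, sub_zero]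
  · rw [lie_lie, h2, lie_zero, rightOp, lie_sub (coeffOp ι d), lie_coeffOp_mulOp_X,
      lie_coeffOp_vec d (hd a), sub_zero, lie_zero, sub_zero]

theorem lie_leftOp_one {r : Module.End k (MvPolynomial ι K)} (hr : r ∈ weyl k J) (v : ι → K) :
    ⁅leftOp k J v, r⁆ 1 = (2 : K) • vec (Matrix.vecMul v J) (r 1) := by
  rw [lie_leftOp hr, two_mul, LinearMap.add_apply, lie_vecOp_one, two_smul]

theorem lie_leftOp_nilpotent (hJ : Jᵀ = -J) (v : ι → K) {r : Module.End k (MvPolynomial ι K)}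
    (hr : r ∈ weyl k J) : ∃ N : ℕ, (fun s => ⁅leftOp k J v, s⁆)^[N] r = 0 := by
  -- On values at `1` the commutator acts as a multiple of a vector field, which is nilpotent there.
  obtain ⟨N, hN⟩ := vec_iterate_eq_zero (Matrix.vecMul v J) (r 1)
  suffices key : ∀ n, (fun s => ⁅leftOp k J v, s⁆)^[n] r ∈ weyl k J ∧
      ((fun s => ⁅leftOp k J v, s⁆)^[n] r) 1 =
        (2 : K) ^ n • (vec (Matrix.vecMul v J))^[n] (r 1) from
    ⟨N, eq_zero_of_apply_one (key N).1 (by rw [(key N).2, hN, smul_zero])⟩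
  intro n
  induction n with
  | zero =>
    rw [Function.iterate_zero_apply, Function.iterate_zero_apply, pow_zero, one_smul]
    exact ⟨hr, rfl⟩
  | succ n ih =>
    rw [Function.iterate_succ_apply', Function.iterate_succ_apply']
    generalize (fun s => ⁅leftOp k J v, s⁆)^[n] r = s at ih ⊢
    refine ⟨lie_mem_weyl (leftOp_mem hJ v) ih.1, ?_⟩
    rw [lie_leftOp_one ih.1, ih.2, Derivation.map_smul, smul_smul, pow_succ']

variable [DecidableEq ι]

/-- Elements of the Weyl algebra that commute with a frame of generators are scalars. -/
theorem eq_scalOp [CharZero k] {η ξ : Matrix ι ι K} (h : (2 : K) • (η * J * ξᵀ) = 1)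
    {r : Module.End k (MvPolynomial ι K)} (hr : r ∈ weyl k J)
    (h0 : ∀ i, ⁅leftOp k J (η i), r⁆ = 0) : r = scalOp k ι (symbol k K ι r) := by
  have h1 : ∀ i, ∑ c, ((2 : K) • (η * J)) i c • pderiv c (r 1) = 0 := by
    intro i
    have h2 := LinearMap.congr_fun (h0 i) 1
    rw [lie_leftOp_one hr, vec_apply, Finset.smul_sum, LinearMap.zero_apply] at h2
    rw [← h2]
    exact Finset.sum_congr rfl fun c _ => mul_smul _ _ _
  have h2 : ξᵀ * ((2 : K) • (η * J)) = 1 := by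
    rw [← Matrix.smul_mul] at h
    exact mul_eq_one_comm.1 h
  have h3 : ∀ b, pderiv b (r 1) = 0 := by
    intro b
    calc pderiv b (r 1) = ∑ c, (1 : Matrix ι ι K) b c • pderiv c (r 1) := by
          simp [Matrix.one_apply, ite_smul]
      _ = ∑ c, ∑ i, (ξᵀ b i * ((2 : K) • (η * J)) i c) • pderiv c (r 1) := by
          simp only [← Finset.sum_smul, ← h2, ← Matrix.mul_apply (M := ξᵀ)]
      _ = ∑ i, ξᵀ b i • ∑ c, ((2 : K) • (η * J)) i c • pderiv c (r 1) := by
          rw [Finset.sum_comm]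
          simp only [Finset.smul_sum, mul_smul]
      _ = 0 := Finset.sum_eq_zero fun i _ => by rw [h1, smul_zero]
  rw [← sub_eq_zero]
  refine eq_zero_of_apply_one (sub_mem hr (scalOp_mem _)) ?_
  rw [LinearMap.sub_apply, scalOp_apply, mul_one, symbol_apply,
    ← eq_C_of_pderiv_eq_zero (k := k) h3, sub_self]

/-- The Weyl algebra with generators and dual frame given by the rows of `η` and `ξ`. -/
noncomputable def fedosovData [CharZero k] (hJ : Jᵀ = -J) (η ξ : Matrix ι ι K)
    (h : (2 : K) • (η * J * ξᵀ) = 1) (d : ι → Derivation k K K)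
    (hd : ∀ i j c, d i (d j c) = d j (d i c)) (hdJ : ∀ i a b, d i (J a b) = 0)
    (ω : Matrix ι ι K) (hω : ω = (2 : K) • (η * J * ηᵀ))
    (hclosed : ∀ i j l, d i (ω j l) + d j (ω l i) + d l (ω i j) = 0) :
    FedosovData k K (Module.End k (MvPolynomial ι K)) ι where
  scal := scalOp k ι
  S := weyl k J
  e i := leftOp k J (η i)
  x i := leftOp k J (ξ i)
  omega := ω
  d := d
  nabla i := coeffOp ι (d i)
  sig := symbol k K ι
  theta := parity k K ι
  scal_mem := scalOp_mem
  lie_scal c r hr := (mem_weyl.1 hr).1 c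
  e_mem i := leftOp_mem hJ _
  x_mem i := leftOp_mem hJ _
  lie_e i j := by
    rw [lie_leftOp_leftOp hJ, hω]
    rfl
  lie_e_x i j := by
    rw [lie_leftOp_leftOp hJ]
    change scalOp k ι (((2 : K) • (η * J * ξᵀ)) i j) = _
    rw [h, Matrix.one_apply]
    split_ifs <;> simp
  nilpotent i r hr := lie_leftOp_nilpotent hJ _ hr
  lie_nabla_scal i c := lie_coeffOp_scalOp _ _
  lie_nabla_mem i r hr := lie_coeffOp_mem _ (hdJ i) hr
  lie_nabla_nabla i j := by
    refine LinearMap.ext fun f => ?_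
    ext s
    simp [Ring.lie_def, hd i j]
  omega_closed := hclosed
  sig_scal_mul c r := by simp [symbol_apply]
  sig_one := by simp [symbol_apply]
  eq_scal r hr h0 := eq_scalOp h hr h0
  theta_theta := parity_parity
  theta_scal := parity_scalOp
  theta_e i := parity_leftOp _
  theta_nabla i := LinearMap.ext fun f => by
    rw [parity_apply, reflect_coeffOp, reflect_reflect]
  theta_mem r hr := parity_mem hr
  sig_theta r := by
    rw [symbol_apply, parity_apply, map_one, constantCoeff_reflect, symbol_apply]
  sig_x i := by rw [symbol_apply, leftOp_one, constantCoeff_lin]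

end WeylModel

namespace WeylModel

open scoped Matrix

/-- Quantization of the nondegenerate bivector `P` in the frame of commuting derivations `d i`,
provided that its inverse `N` is a closed `2`-form and that `P` is congruent to a matrix of
constants. -/
theorem exists_deformation {k : Type u} {K : Type v} {ι : Type} [Field k] [CharZero k]
    [Field K] [Algebra k K] [Fintype ι] [DecidableEq ι] {J ξ P N : Matrix ι ι K} (hJ : Jᵀ = -J)
    (hP : ξ * J * ξᵀ = P) (hN : N * P = 1) (hNskew : ∀ i j, N i j = -N j i)
    (d : ι → Derivation k K K) (hd : ∀ i j c, d i (d j c) = d j (d i c))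
    (hdJ : ∀ i a b, d i (J a b) = 0)
    (hclosed : ∀ i j l, d i (N j l) + d j (N l i) + d l (N i j) = 0) :
    ∃ D : FormalDeformation k K, ∀ a b : K,
      PowerSeries.coeff 1 (D.star a b) = ∑ i, ∑ j, d i a * d j b * P i j := by
  have h2 : algebraMap k K 2 ≠ 0 := (map_ne_zero _).2 two_ne_zero
  have h2' : (2 : K) = algebraMap k K 2 := (map_ofNat _ 2).symm
  -- The generators are the frame to which the rows of `ξ` are dual, and their commutators are then
  -- the closed form `-N / 2`.
  let η : Matrix ι ι K := (2 : K)⁻¹ • (N * ξ)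
  have hη : (2 : K) • (η * J * ξᵀ) = 1 := by
    rw [Matrix.smul_mul, Matrix.smul_mul, smul_smul, h2', mul_inv_cancel₀ h2, one_smul,
      Matrix.mul_assoc, Matrix.mul_assoc, ← Matrix.mul_assoc ξ, hP, hN]
  have hω : (2 : K) • (η * J * ηᵀ) = -((2 : K)⁻¹ • N) := by
    have hNt : Nᵀ = -N := by
      ext i j
      exact hNskew j i
    rw [Matrix.transpose_smul, Matrix.transpose_mul, Matrix.mul_smul, smul_comm,
      ← Matrix.mul_assoc, ← Matrix.smul_mul, hη, Matrix.one_mul, hNt, smul_neg]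
  have hhalf : ∀ i c, d i (-((2 : K)⁻¹ * c)) = -((2 : K)⁻¹ * d i c) := by
    intro i c
    rw [map_neg, h2', ← map_inv₀, ← Algebra.smul_def, Derivation.map_smul, Algebra.smul_def]
  obtain ⟨D, hD⟩ := (fedosovData hJ η ξ hη d hd hdJ (-((2 : K)⁻¹ • N)) hω.symm fun i j l => by
    change d i (-((2 : K)⁻¹ * N j l)) + d j (-((2 : K)⁻¹ * N l i)) +
      d l (-((2 : K)⁻¹ * N i j)) = 0
    rw [hhalf, hhalf, hhalf]
    linear_combination (-(2 : K)⁻¹) * hclosed i j l).exists_deformation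
  refine ⟨D, fun a c => (hD a c).trans ?_⟩
  refine Finset.sum_congr rfl fun i _ => Finset.sum_congr rfl fun j _ => ?_
  rw [← hP]
  congr 1
  exact symbol_leftOp_mul_leftOp _ _

end WeylModel

/-! ### Derivations of fields of finite transcendence degree -/

section Derivations

variable {k K : Type*} [Field k] [CharZero k] [Field K] [Algebra k K]

/-- In characteristic zero, a derivation that vanishes on a transcendence basis is zero. -/
theorem Derivation.eq_zero_of_isTranscendenceBasis {ι : Type*} {b : ι → K}
    (hb : IsTranscendenceBasis k b) (D : Derivation k K K) (h : ∀ i, D (b i) = 0) : D = 0 := by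
  let L : IntermediateField k K :=
    { carrier := {x | D x = 0}
      mul_mem' := fun {x y} hx hy => by
        change D (x * y) = 0
        rw [D.leibniz, show D x = 0 from hx, show D y = 0 from hy, smul_zero, smul_zero, add_zero]
      add_mem' := fun {x y} hx hy => by
        change D (x + y) = 0
        rw [map_add, show D x = 0 from hx, show D y = 0 from hy, add_zero]
      algebraMap_mem' := fun c => D.map_algebraMap c
      inv_mem' := fun x hx => by
        change D x⁻¹ = 0
        rw [Derivation.leibniz_inv, show D x = 0 from hx, smul_zero] }
  have halg : Algebra.IsAlgebraic L K := by
    have h1 := hb.isAlgebraic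
    have hle : Algebra.adjoin k (Set.range b) ≤ L.toSubalgebra :=
      Algebra.adjoin_le (by rintro _ ⟨i, rfl⟩; exact h i)
    refine ⟨fun x => ?_⟩
    obtain ⟨p, hp, hpx⟩ := h1.isAlgebraic x
    refine ⟨p.map (Subalgebra.inclusion hle).toRingHom, ?_, ?_⟩
    · rwa [Ne, Polynomial.map_eq_zero_iff (Subalgebra.inclusion_injective hle)]
    · rw [Polynomial.aeval_def, Polynomial.eval₂_map]
      exact hpx
  let D' : Derivation L K K :=
    { toFun := D
      map_add' := map_add D
      map_smul' := fun c x => by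
        rw [Algebra.smul_def, D.leibniz, show D (algebraMap L K c) = 0 from c.2, smul_zero,
          add_zero, RingHom.id_apply]
        rfl
      map_one_eq_zero' := D.map_one_eq_zero
      leibniz' := D.leibniz }
  have hD' : D' = 0 := by
    have : Algebra.FormallyUnramified L K := Algebra.FormallyUnramified.of_isSeparable L K
    rw [← D'.liftKaehlerDifferential_comp]
    ext x
    change D'.liftKaehlerDifferential (KaehlerDifferential.D L K x) = 0
    rw [Subsingleton.elim (KaehlerDifferential.D L K x) 0, map_zero]
  exact Derivation.ext fun x => Derivation.congr_fun hD' x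

theorem Derivation.finiteDimensional_of_trdeg_lt (htr : Algebra.trdeg k K < Cardinal.aleph0) :
    FiniteDimensional K (Derivation k K K) := by
  obtain ⟨s, hs⟩ := exists_isTranscendenceBasis k K
  have hfin : Finite s := by
    rw [← Cardinal.lt_aleph0_iff_finite, hs.cardinalMk_eq_trdeg]
    exact htr
  let φ : Derivation k K K →ₗ[K] (s → K) :=
    { toFun := fun D i => D i
      map_add' := fun _ _ => rfl
      map_smul' := fun _ _ => rfl }
  refine FiniteDimensional.of_injective φ ((injective_iff_map_eq_zero φ).2 fun D hD => ?_)
  exact D.eq_zero_of_isTranscendenceBasis hs fun i => congrFun hD i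

end Derivations

/-! ### Symplectic linear algebra -/

section Gram

variable {K V : Type*} [Field K] [AddCommGroup V] [Module K V] [FiniteDimensional K V]

theorem exists_basis_mem {s : Set V} (hs : Submodule.span K s = ⊤) :
    ∃ b : Module.Basis (Fin (Module.finrank K V)) K V, ∀ i, b i ∈ s := by
  let b := Module.Basis.ofSpan hs.ge
  refine ⟨b.reindex (b.indexEquiv (Module.finBasis K V)), fun i => ?_⟩
  rw [Module.Basis.reindex_apply]
  exact Module.Basis.ofSpan_subset hs.ge ⟨_, rfl⟩

/-- Symplectic linear algebra: a subspace is spanned by vectors on which an alternating form takes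
values in the prime ring. -/
theorem exists_span_eq_of_isAlt (B : V →ₗ[K] V →ₗ[K] K) (hB : ∀ x, B x x = 0)
    (U : Submodule K V) : ∃ s : Set V, Submodule.span K s = U ∧
      ∀ x ∈ s, ∀ y ∈ s, ∃ n : ℤ, B x y = n := by
  have hskew : ∀ x y, B x y = -B y x := by
    intro x y
    have h := hB (x + y)
    simp only [map_add, LinearMap.add_apply, hB, zero_add, add_zero] at h
    exact eq_neg_of_add_eq_zero_right h
  induction hn : Module.finrank K U using Nat.strong_induction_on generalizing U with
  | _ n ih =>
  by_cases h0 : ∀ x ∈ U, ∀ y ∈ U, B x y = 0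
  · exact ⟨U, Submodule.span_eq U, fun x hx y hy => ⟨0, by rw [h0 x hx y hy, Int.cast_zero]⟩⟩
  -- Split off a hyperbolic plane spanned by `v` and `w`.
  push Not at h0
  obtain ⟨v, hv, w', hw', hvw'⟩ := h0
  obtain ⟨w, hw, hvw⟩ : ∃ w ∈ U, B v w = 1 :=
    ⟨(B v w')⁻¹ • w', U.smul_mem _ hw', by rw [map_smul, smul_eq_mul, inv_mul_cancel₀ hvw']⟩
  let U' : Submodule K V := U ⊓ LinearMap.ker (B v) ⊓ LinearMap.ker (B w)
  have hU' : ∀ x ∈ U', x ∈ U ∧ B v x = 0 ∧ B w x = 0 := fun x hx => ⟨hx.1.1, hx.1.2, hx.2⟩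
  have hlt : Module.finrank K U' < n := by
    rw [← hn]
    refine Submodule.finrank_lt_finrank_of_lt (lt_of_le_of_ne (fun x hx => (hU' x hx).1) ?_)
    intro h
    have := (hU' w (h ▸ hw)).2.1
    rw [hvw] at this
    exact one_ne_zero this
  obtain ⟨s, hs, hsB⟩ := ih _ hlt U' rfl
  have hsU : ∀ x ∈ s, x ∈ U' := fun x hx => hs ▸ Submodule.subset_span hx
  have hwv : B w v = -1 := by rw [hskew, hvw]
  refine ⟨insert v (insert w s), le_antisymm (Submodule.span_le.2 ?_) fun x hx => ?_, ?_⟩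
  · rintro x (rfl | rfl | hx)
    exacts [hv, hw, (hU' x (hsU x hx)).1]
  · have hx' : x - B v x • w + B w x • v ∈ U' := by
      refine ⟨⟨add_mem (sub_mem hx (U.smul_mem _ hw)) (U.smul_mem _ hv), ?_⟩, ?_⟩
      · change B v _ = 0
        simp [hvw, hB]
      · change B w _ = 0
        simp [hwv, hB]
    rw [show x = (x - B v x • w + B w x • v) + B v x • w - B w x • v by abel]
    have hsub : s ⊆ insert v (insert w s) := fun _ h => Or.inr (Or.inr h)
    refine sub_mem (add_mem (Submodule.span_mono hsub (hs ▸ hx')) ?_) ?_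
    · exact Submodule.smul_mem _ _ (Submodule.subset_span (Or.inr (Or.inl rfl)))
    · exact Submodule.smul_mem _ _ (Submodule.subset_span (Or.inl rfl))
  · rintro x (rfl | rfl | hx) y (rfl | rfl | hy)
    · exact ⟨0, by rw [hB, Int.cast_zero]⟩
    · exact ⟨1, by rw [hvw, Int.cast_one]⟩
    · exact ⟨0, by rw [(hU' y (hsU y hy)).2.1, Int.cast_zero]⟩
    · exact ⟨-1, by rw [hwv]; simp⟩
    · exact ⟨0, by rw [hB, Int.cast_zero]⟩
    · exact ⟨0, by rw [(hU' y (hsU y hy)).2.2, Int.cast_zero]⟩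
    · exact ⟨0, by rw [hskew, (hU' x (hsU x hx)).2.1]; simp⟩
    · exact ⟨0, by rw [hskew, (hU' x (hsU x hx)).2.2]; simp⟩
    · exact hsB x hx y hy

end Gram

/-! ### Poisson brackets on fields -/

namespace PoissonBracket

section

variable {k : Type u} {K : Type v} [Field k] [Field K] [Algebra k K] (f : PoissonBracket k K)

theorem span_range_toWeak : Submodule.span K (Set.range f.toWeak) = ⊤ := by
  apply Submodule.map_injective_of_injective f.weakHamiltonian.subtype_injective
  rw [Submodule.map_span, Submodule.map_top, Submodule.range_subtype, ← Set.range_comp]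
  rfl

/-- The form is nondegenerate, since `φ(x, f(b, ·)) = x(b)` for all `b`. -/
theorem toDual_injective : Function.Injective f.toDual := by
  refine (injective_iff_map_eq_zero _).2 fun x hx => Subtype.ext (Derivation.ext fun b => ?_)
  rw [← f.form_apply_toWeak x b]
  exact LinearMap.congr_fun hx _

theorem form_skew (x y : f.weakHamiltonian) : f.form x y = -f.form y x := by
  have h : f.form = -f.form.flip := by
    refine LinearMap.ext_on_range f.span_range_toWeak fun a =>
      LinearMap.ext_on_range f.span_range_toWeak fun b => ?_
    rw [LinearMap.neg_apply, LinearMap.neg_apply, LinearMap.flip_apply, f.form_toWeak,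
      f.form_toWeak, f.skew]
  conv_lhs => rw [h]
  rfl

theorem lie_hamiltonian (a b : K) :
    ⁅f.hamiltonian a, f.hamiltonian b⁆ = f.hamiltonian (f.bracket a b) := by
  ext c
  have h := f.jacobi a b c
  rw [f.skew (f.bracket b c) a, f.skew (f.bracket c a) b, f.skew c a, map_neg] at h
  simp only [Derivation.commutator_apply, hamiltonian_apply]
  linear_combination -h

theorem lie_mem_weakHamiltonian {D D' : Derivation k K K} (hD : D ∈ f.weakHamiltonian)
    (hD' : D' ∈ f.weakHamiltonian) : ⁅D, D'⁆ ∈ f.weakHamiltonian := by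
  have smul_right : ∀ (E E' : Derivation k K K) (c : K), ⁅E, c • E'⁆ = E c • E' + c • ⁅E, E'⁆ := by
    intro E E' c
    ext x
    simp only [Derivation.commutator_apply, Derivation.add_apply, Derivation.smul_apply,
      smul_eq_mul, Derivation.leibniz]
    ring
  have key : ∀ a, ∀ E ∈ f.weakHamiltonian, ⁅f.hamiltonian a, E⁆ ∈ f.weakHamiltonian := by
    intro a E hE
    induction hE using Submodule.span_induction with
    | mem x hx =>
      obtain ⟨b, rfl⟩ := hx
      rw [lie_hamiltonian]
      exact Submodule.subset_span ⟨_, rfl⟩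
    | zero => rw [lie_zero]; exact zero_mem _
    | add x y _ _ hx hy => rw [lie_add]; exact add_mem hx hy
    | smul c x hx h =>
      rw [smul_right]
      exact add_mem (Submodule.smul_mem _ _ hx) (Submodule.smul_mem _ _ h)
  induction hD using Submodule.span_induction with
  | mem x hx =>
    obtain ⟨a, rfl⟩ := hx
    exact key a D' hD'
  | zero => rw [zero_lie]; exact zero_mem _
  | add x y _ _ hx hy => rw [add_lie]; exact add_mem hx hy
  | smul c x hx h =>
    rw [← lie_skew, smul_right, ← lie_skew D' x, smul_neg]
    exact neg_mem (add_mem (Submodule.smul_mem _ _ hx) (neg_mem (Submodule.smul_mem _ _ h)))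

end

end PoissonBracket

namespace PoissonBracket

open scoped Matrix

section

variable {k : Type u} {K : Type v} [Field k] [Field K] [Algebra k K] (f : PoissonBracket k K)
  {n : ℕ} (y : Fin n → K)

/-- The matrix of brackets of the elements `y i`. -/
def gram : Matrix (Fin n) (Fin n) K := Matrix.of fun i j => f.bracket (y i) (y j)

theorem gram_apply (i j : Fin n) : f.gram y i j = f.bracket (y i) (y j) := rfl

/-- The derivation dual to `y i` in the frame of Hamiltonian derivations of the elements `y j`. -/
noncomputable def partialDeriv (i : Fin n) : Derivation k K K :=
  ∑ j, (f.gram y)⁻¹ i j • f.hamiltonian (y j)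

theorem partialDeriv_apply (i : Fin n) (c : K) :
    f.partialDeriv y i c = ∑ j, (f.gram y)⁻¹ i j * f.bracket (y j) c := by
  rw [partialDeriv, ← Derivation.coeFnAddMonoidHom_apply, map_sum, Finset.sum_apply]
  rfl

theorem partialDeriv_mem (i : Fin n) : f.partialDeriv y i ∈ f.weakHamiltonian :=
  sum_mem fun _ _ => Submodule.smul_mem _ _ (Submodule.subset_span ⟨_, rfl⟩)

variable {y} (b : Module.Basis (Fin n) K f.weakHamiltonian) (hb : ∀ i, b i = f.toWeak (y i))

include b hb

/-- An element of `E` is determined by its values on the `y i`, by nondegeneracy of the form. -/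
theorem eq_zero_of_mem_weakHamiltonian {D : Derivation k K K} (hD : D ∈ f.weakHamiltonian)
    (h : ∀ i, D (y i) = 0) : D = 0 := by
  have h0 : f.toDual ⟨D, hD⟩ = 0 := b.ext fun i => by
    rw [hb]
    exact (f.form_apply_toWeak _ _).trans (h i)
  have h1 := f.toDual_injective (h0.trans (map_zero _).symm)
  exact congrArg Subtype.val h1

theorem isUnit_det_gram : IsUnit (f.gram y).det := by
  rw [isUnit_iff_ne_zero]
  intro h
  obtain ⟨v, hv, hv0⟩ := Matrix.exists_vecMul_eq_zero_iff.2 h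
  refine hv ?_
  have hz : (∑ i, v i • b i : f.weakHamiltonian) = 0 := by
    refine f.toDual_injective ((b.ext fun j => ?_).trans (map_zero _).symm)
    have h' := congrFun hv0 j
    rw [hb]
    change f.form _ _ = 0
    simp only [map_sum, LinearMap.sum_apply, map_smul, LinearMap.smul_apply, hb, f.form_toWeak]
    exact h'
  funext i
  exact Fintype.linearIndependent_iff.1 b.linearIndependent v hz i

theorem gram_inv_mul : (f.gram y)⁻¹ * f.gram y = 1 :=
  Matrix.nonsing_inv_mul _ (f.isUnit_det_gram b hb)

theorem gram_mul_inv : f.gram y * (f.gram y)⁻¹ = 1 :=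
  Matrix.mul_nonsing_inv _ (f.isUnit_det_gram b hb)

theorem partialDeriv_coord (i j : Fin n) :
    f.partialDeriv y i (y j) = (1 : Matrix (Fin n) (Fin n) K) i j := by
  rw [partialDeriv_apply, ← f.gram_inv_mul b hb]
  rfl

/-- The commutator lies in `E` and kills the `y l`, because the values there are constants. -/
theorem partialDeriv_comm (i j : Fin n) (c : K) :
    f.partialDeriv y i (f.partialDeriv y j c) = f.partialDeriv y j (f.partialDeriv y i c) := by
  have h : ⁅f.partialDeriv y i, f.partialDeriv y j⁆ = 0 := by
    refine f.eq_zero_of_mem_weakHamiltonian b hb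
      (f.lie_mem_weakHamiltonian (f.partialDeriv_mem y i) (f.partialDeriv_mem y j)) fun l => ?_
    have h0 : ∀ (D : Derivation k K K) (a b : Fin n),
        D ((1 : Matrix (Fin n) (Fin n) K) a b) = 0 := by
      intro D a b
      rw [Matrix.one_apply]
      split_ifs
      exacts [D.map_one_eq_zero, map_zero D]
    rw [Derivation.commutator_apply, f.partialDeriv_coord b hb, f.partialDeriv_coord b hb, h0, h0,
      sub_zero]
  have h' := Derivation.congr_fun h c
  rwa [Derivation.commutator_apply, Derivation.zero_apply, sub_eq_zero] at h'

theorem bracket_eq_sum (a c : K) :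
    f.bracket a c = ∑ j, f.bracket a (y j) * f.partialDeriv y j c := by
  have h : f.hamiltonian a - ∑ j, f.bracket a (y j) • f.partialDeriv y j = 0 := by
    refine f.eq_zero_of_mem_weakHamiltonian b hb
      (sub_mem (Submodule.subset_span ⟨_, rfl⟩)
        (sum_mem fun j _ => Submodule.smul_mem _ _ (f.partialDeriv_mem y j))) fun l => ?_
    rw [Derivation.sub_apply, ← Derivation.coeFnAddMonoidHom_apply (∑ j, _), map_sum,
      Finset.sum_apply]
    simp only [Derivation.coeFnAddMonoidHom_apply, Derivation.smul_apply,
      f.partialDeriv_coord b hb, Matrix.one_apply, smul_eq_mul, mul_ite, mul_one, mul_zero,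
      Finset.sum_ite_eq', Finset.mem_univ, if_true, hamiltonian_apply, sub_self]
  have h' := Derivation.congr_fun h c
  rw [Derivation.sub_apply, ← Derivation.coeFnAddMonoidHom_apply (∑ j, _), map_sum,
    Finset.sum_apply, Derivation.zero_apply, sub_eq_zero] at h'
  exact h'

/-- The bracket is the bivector `gram` in the commuting frame `partialDeriv`. -/
theorem bracket_eq_sum_sum (a c : K) : f.bracket a c =
    ∑ i, ∑ j, f.partialDeriv y i a * f.partialDeriv y j c * f.gram y i j := by
  rw [f.bracket_eq_sum b hb, Finset.sum_comm]
  refine Finset.sum_congr rfl fun j _ => ?_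
  rw [f.skew a (y j), f.bracket_eq_sum b hb, ← Finset.sum_neg_distrib, Finset.sum_mul]
  refine Finset.sum_congr rfl fun i _ => ?_
  rw [gram_apply, f.skew (y i) (y j)]
  ring

theorem gram_inv_skew (i j : Fin n) : (f.gram y)⁻¹ i j = -(f.gram y)⁻¹ j i := by
  have h : (f.gram y)ᵀ = -f.gram y := by
    ext i j
    rw [Matrix.transpose_apply, Matrix.neg_apply, gram_apply, gram_apply, f.skew]
  have h' : ((f.gram y)⁻¹)ᵀ = -(f.gram y)⁻¹ := by
    rw [Matrix.transpose_nonsing_inv, h]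
    exact Matrix.inv_eq_right_inv (by rw [neg_mul_neg, f.gram_mul_inv b hb])
  exact congrFun (congrFun h' j) i

/-- The derivative of the inverse matrix. -/
theorem derivation_gram_inv (D : Derivation k K K) (j l : Fin n) : D ((f.gram y)⁻¹ j l) =
    ∑ p, ∑ q, (f.gram y)⁻¹ j p * (f.gram y)⁻¹ l q * D (f.gram y p q) := by
  have hmul : ∀ M M' : Matrix (Fin n) (Fin n) K,
      (M * M').map D = M.map D * M' + M * M'.map D := by
    intro M M'
    ext i j
    simp only [Matrix.map_apply, Matrix.mul_apply, Matrix.add_apply, map_sum, Derivation.leibniz,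
      smul_eq_mul, ← Finset.sum_add_distrib]
    exact Finset.sum_congr rfl fun _ _ => by ring
  have h1 : (1 : Matrix (Fin n) (Fin n) K).map D = 0 := by
    ext i j
    rw [Matrix.map_apply, Matrix.one_apply]
    split_ifs
    exacts [D.map_one_eq_zero, map_zero D]
  have h2 := hmul (f.gram y)⁻¹ (f.gram y)
  rw [f.gram_inv_mul b hb, h1] at h2
  have h3 : (f.gram y)⁻¹.map D = -((f.gram y)⁻¹ * (f.gram y).map D * (f.gram y)⁻¹) := by
    rw [← mul_one ((f.gram y)⁻¹.map D), ← f.gram_mul_inv b hb, ← mul_assoc,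
      eq_neg_of_add_eq_zero_left h2.symm, neg_mul]
  have h4 := congrFun (congrFun h3 j) l
  rw [Matrix.map_apply] at h4
  rw [h4, Matrix.neg_apply, Matrix.mul_apply, ← Finset.sum_neg_distrib, Finset.sum_comm]
  refine Finset.sum_congr rfl fun q _ => ?_
  rw [Matrix.mul_apply, Finset.sum_mul, ← Finset.sum_neg_distrib]
  refine Finset.sum_congr rfl fun p _ => ?_
  rw [f.gram_inv_skew b hb q l, Matrix.map_apply]
  ring

/-- The Jacobi identity makes the inverse of the bivector a closed `2`-form. -/
theorem gram_inv_closed (i j l : Fin n) : f.partialDeriv y i ((f.gram y)⁻¹ j l) +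
    f.partialDeriv y j ((f.gram y)⁻¹ l i) + f.partialDeriv y l ((f.gram y)⁻¹ i j) = 0 := by
  let N := (f.gram y)⁻¹
  let T : Fin n → Fin n → Fin n → K := fun a p q => f.bracket (y a) (f.bracket (y p) (y q))
  have h : ∀ i j l, f.partialDeriv y i (N j l) =
      ∑ a, ∑ p, ∑ q, N i a * N j p * N l q * T a p q := by
    intro i j l
    rw [f.derivation_gram_inv b hb]
    simp only [partialDeriv_apply, Finset.mul_sum]
    calc _ = ∑ p, ∑ a, ∑ q, N i a * N j p * N l q * T a p q := by
          refine Finset.sum_congr rfl fun p _ => ?_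
          rw [Finset.sum_comm]
          refine Finset.sum_congr rfl fun a _ => Finset.sum_congr rfl fun q _ => ?_
          rw [gram_apply]
          simp only [N, T]
          ring
      _ = _ := Finset.sum_comm
  have hT : ∀ a p q, T a p q + T p q a + T q a p = 0 := by
    intro a p q
    have h := f.jacobi (y p) (y q) (y a)
    rw [f.skew (f.bracket (y p) (y q)), f.skew (f.bracket (y q) (y a)),
      f.skew (f.bracket (y a) (y p))] at h
    simp only [T]
    linear_combination -h
  have h2 : f.partialDeriv y j (N l i) = ∑ a, ∑ p, ∑ q, N i a * N j p * N l q * T p q a := by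
    rw [h]
    calc _ = ∑ p, ∑ a, ∑ q, N j p * N l q * N i a * T p q a :=
          Finset.sum_congr rfl fun p _ => Finset.sum_comm
      _ = ∑ a, ∑ p, ∑ q, N j p * N l q * N i a * T p q a := Finset.sum_comm
      _ = _ := Finset.sum_congr rfl fun a _ => Finset.sum_congr rfl fun p _ =>
          Finset.sum_congr rfl fun q _ => by ring
  have h3 : f.partialDeriv y l (N i j) = ∑ a, ∑ p, ∑ q, N i a * N j p * N l q * T q a p := by
    rw [h]
    calc _ = ∑ a, ∑ q, ∑ p, N l q * N i a * N j p * T q a p := Finset.sum_comm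
      _ = ∑ a, ∑ p, ∑ q, N l q * N i a * N j p * T q a p :=
          Finset.sum_congr rfl fun a _ => Finset.sum_comm
      _ = _ := Finset.sum_congr rfl fun a _ => Finset.sum_congr rfl fun p _ =>
          Finset.sum_congr rfl fun q _ => by ring
  change f.partialDeriv y i (N j l) + f.partialDeriv y j (N l i) + f.partialDeriv y l (N i j) = 0
  rw [h, h2, h3, ← Finset.sum_add_distrib, ← Finset.sum_add_distrib]
  refine Finset.sum_eq_zero fun a _ => ?_
  rw [← Finset.sum_add_distrib, ← Finset.sum_add_distrib]
  refine Finset.sum_eq_zero fun p _ => ?_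
  rw [← Finset.sum_add_distrib, ← Finset.sum_add_distrib]
  refine Finset.sum_eq_zero fun q _ => ?_
  rw [← mul_add, ← mul_add, hT, mul_zero]

end

section

variable {k : Type u} {K : Type v} [Field k] [CharZero k] [Field K] [Algebra k K]
  (f : PoissonBracket k K) [FiniteDimensional K f.weakHamiltonian]

/-- Every Gram matrix of the form is congruent to one with integral entries. -/
theorem exists_congruent_gram {n : ℕ} (hn : n = Module.finrank K f.weakHamiltonian)
    (y : Fin n → K) : ∃ J ξ : Matrix (Fin n) (Fin n) K, Jᵀ = -J ∧ (∀ a c, ∃ m : ℤ, J a c = m) ∧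
      ξ * J * ξᵀ = f.gram y := by
  subst hn
  have hself : ∀ x, f.form x x = 0 := by
    have : CharZero K := charZero_of_injective_algebraMap (algebraMap k K).injective
    exact fun x => self_eq_neg.1 (f.form_skew x x)
  obtain ⟨s, hs, hsB⟩ := exists_span_eq_of_isAlt f.form hself ⊤
  obtain ⟨z, hz⟩ := exists_basis_mem hs
  refine ⟨Matrix.of fun a c => f.form (z a) (z c), Matrix.of fun i a => z.repr (f.toWeak (y i)) a,
    ?_, fun a c => hsB _ (hz a) _ (hz c), ?_⟩
  · ext a c
    exact f.form_skew _ _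
  · ext i j
    rw [gram_apply, ← f.form_toWeak, ← LinearMap.sum_repr_mul_repr_mul z z, Matrix.mul_assoc,
      Finsupp.sum_fintype _ _ (by simp), Matrix.mul_apply]
    refine Finset.sum_congr rfl fun a _ => ?_
    rw [Finsupp.sum_fintype _ _ (by simp), Matrix.mul_apply, Finset.mul_sum]
    refine Finset.sum_congr rfl fun c _ => ?_
    simp only [Matrix.of_apply, Matrix.transpose_apply, smul_eq_mul]
    ring

/-- The Hamiltonian basis supplies the commuting frame, in which the inverse Gram matrix is closed,
so that the Weyl algebra quantizes the bracket. -/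
theorem isQuantizable_of_finiteDimensional : f.IsQuantizable := by
  obtain ⟨b, hbs⟩ := exists_basis_mem f.span_range_toWeak
  choose y hy using hbs
  have hb : ∀ i, b i = f.toWeak (y i) := fun i => (hy i).symm
  obtain ⟨J, ξ, hJ, hJm, hgram⟩ := f.exists_congruent_gram rfl y
  obtain ⟨D, hD⟩ := WeylModel.exists_deformation hJ hgram (f.gram_inv_mul b hb)
    (f.gram_inv_skew b hb) (f.partialDeriv y) (f.partialDeriv_comm b hb) (fun i a c => by
      obtain ⟨m, hm⟩ := hJm a c
      rw [hm, Derivation.map_intCast]) (f.gram_inv_closed b hb)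
  exact ⟨D, fun a c => (hD a c).trans (f.bracket_eq_sum_sum b hb a c).symm⟩

end

end PoissonBracket

end Commutators

theorem mainTheorem2 {k : Type u} {K : Type v} [Field k] [CharZero k] [Field K] [Algebra k K]
    (htr : Algebra.trdeg k K < Cardinal.aleph0) (f : PoissonBracket k K) :
    f.IsQuantizable ∧
      FiniteDimensional K f.weakHamiltonian ∧
      Function.Injective f.toDual ∧
      Module.finrank K f.weakHamiltonian =
        Module.finrank K (Module.Dual K f.weakHamiltonian) ∧
      f.IsLocallyFree ∧ f.IsNonsingular := by
  have := Derivation.finiteDimensional_of_trdeg_lt htr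
  have hfin : FiniteDimensional K f.weakHamiltonian := inferInstance
  have hrank : Module.finrank K f.weakHamiltonian =
      Module.finrank K (Module.Dual K f.weakHamiltonian) := Subspace.dual_finrank_eq.symm
  refine ⟨f.isQuantizable_of_finiteDimensional, hfin, f.toDual_injective, hrank,
    ⟨hfin, inferInstance⟩, f.toDual_injective, ?_⟩
  exact (LinearMap.injective_iff_surjective_of_finrank_eq_finrank hrank).1 f.toDual_injective
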